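/- Let $\mathcal H$ be a separable complex Hilbert space, $\mathcal L$ the Banach algebra of bounded linear operators on $\mathcal H$, and let $T\in\mathcal L$ be compact and Hermitian with spectral expansion $T=\sum_i\lambda_iP_i$, where the $\lambda_i\in\mathbb R$ are the eigenvalues (including $0$ if $\ker T\ne\{0\}$) repeated according to multiplicity, and the $P_i$ are mutually orthogonal one-dimensional orthogonal projections with $\sum_iP_i=I$ strongly. Let $\Omega\subset\mathbb C$ be bounded and open with $\sigma(T)\subset\Omega$, whose boundary $\Gamma=\partial\Omega$ is smooth (finitely many disjoint regular simple closed $C^1$ curves) and positively oriented (winding number $1$ about the points of $\Omega$, $0$ about the points outside $\overline\Omega$). Let $D\supset\overline\Omega$ be open, let $\varphi:D\to\mathbb C$ be analytic, and put, with $R(z,A)=(zI-A)^{-1}$, $$\varphi(A)=\frac1{2\pi i}\int_\Gamma\varphi(z)R(z,A)\,dz\qquad(\sigma(A)\subset\Omega).$$ Then $\sigma(A)\subset\Omega$ for all $A\in\mathcal L$ near $T$, the map $A\mapsto\varphi(A)$ is Fréchet differentiable in a neighbourhood of $T$ in $\mathcal L$ and twice Fréchet differentiable at $T$, and for every $G\in\mathcal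 L$ the following holds, all series converging in the strong operator topology (finite partial sums over products of finite index sets, each of which increases to the whole index set independently of the others). (1) The first Fréchet derivative at $T$ in direction $G$ is $$D_T\varphi[G]=\frac1{2\pi i}\int_\Gamma\varphi(z)R(z,T)GR(z,T)\,dz=\sum_{\lambda_i=\lambda_k}\varphi'(\lambda_i)\,P_iGP_k+\sum_{\lambda_i\ne\lambda_k}\frac{\varphi(\lambda_k)-\varphi(\lambda_i)}{\lambda_k-\lambda_i}\,P_iGP_k .$$ (2) The second Fréchet derivative of $A\mapsto\varphi(A)$ at $T$, evaluated at $(G,G)$, equals $2\,Q_T[G]$, where $$Q_T[G]=\frac1{2\pi i}\int_\Gamma\varphi(z)R(z,T)\bigl(GR(z,T)\bigr)^2dz$$ and $$\begin{aligned}Q_T[G]={}&\sum_{\lambda_i,\lambda_j,\lambda_k\text{ pairwise different}}\frac{(\lambda_j-\lambda_k)\varphi(\lambda_i)+(\lambda_k-\lambda_i)\varphi(\lambda_j)+(\lambda_i-\lambda_j)\varphi(\lambda_k)}{\lambda_i^2(\lambda_j-\lambda_k)+\lambda_j^2(\lambda_k-\lambda_i)+\lambda_k^2(\lambda_i-\lambda_j)}\,P_iGP_jGP_k\\&+\sum_{\text{exactly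 two of }\lambda_i,\lambda_j,\lambda_k\text{ equal}}\frac1{\mu-\nu}\left[\varphi'(\mu)-\frac{\varphi(\mu)-\varphi(\nu)}{\mu-\nu}\right]P_iGP_jGP_k\\&+\sum_{\lambda_i=\lambda_j=\lambda_k}\tfrac12\varphi''(\lambda_i)\,P_iGP_jGP_k ,\end{aligned}$$ where in the middle sum $\mu$ denotes the value taken twice and $\nu$ the value taken once among $\lambda_i,\lambda_j,\lambda_k$. -/

import Mathlib

open Filter Topology

namespace ResolventCalculus

noncomputable section

/-- The contour integral `∫_Γ f(z) dz` over a finite family of closed curves,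
each parametrised over `[0, 1]`. -/
def contourIntegral {E : Type*} [NormedAddCommGroup E] [NormedSpace ℂ E]
    {n : ℕ} (γ : Fin n → ℝ → ℂ) (f : ℂ → E) : E :=
  ∑ k, ∫ t in (0 : ℝ)..1, deriv (γ k) t • f (γ k t)

/-- A parametrisation of the positively oriented smooth boundary of a plane set `Ω`: the boundary
is a finite disjoint union of regular simple closed curves of class `C¹`, which as a cycle have
winding number `1` about every point of `Ω` and `0` about every point off the closure of `Ω`. -/
structure SmoothBoundary (Ω : Set ℂ) where
  /-- the number of boundary curves -/
  n : ℕ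
  /-- the boundary curves, parametrised periodically with period `1` -/
  γ : Fin n → ℝ → ℂ
  contDiff : ∀ k, ContDiff ℝ 1 (γ k)
  periodic : ∀ k, Function.Periodic (γ k) 1
  deriv_ne_zero : ∀ k t, deriv (γ k) t ≠ 0
  injOn : ∀ k, Set.InjOn (γ k) (Set.Ico 0 1)
  disjoint : Pairwise fun k l => Disjoint (Set.range (γ k)) (Set.range (γ l))
  iUnion_range : ⋃ k, Set.range (γ k) = frontier Ω
  winding_inside : ∀ w ∈ Ω,
    contourIntegral γ (fun z => (z - w)⁻¹) = 2 * Real.pi * Complex.I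
  winding_outside : ∀ w ∉ closure Ω, contourIntegral γ (fun z => (z - w)⁻¹) = 0

variable {H : Type*} [NormedAddCommGroup H] [InnerProductSpace ℂ H] [CompleteSpace H]

/-- `φ(T) = (1 / 2πi) ∫_Γ φ(z) R(z, T) dz`, where `R(z, T) = (z - T)⁻¹`. -/
def calculus {Ω : Set ℂ} (Γ : SmoothBoundary Ω) (φ : ℂ → ℂ) (T : H →L[ℂ] H) : H →L[ℂ] H :=
  (2 * Real.pi * Complex.I : ℂ)⁻¹ • contourIntegral Γ.γ (fun z => φ z • resolvent T z)

/-- `(1 / 2πi) ∫_Γ φ(z) R(z, T) G R(z, T) dz`. -/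
def firstOrderTerm {Ω : Set ℂ} (Γ : SmoothBoundary Ω) (φ : ℂ → ℂ) (T G : H →L[ℂ] H) :
    H →L[ℂ] H :=
  (2 * Real.pi * Complex.I : ℂ)⁻¹ •
    contourIntegral Γ.γ (fun z => φ z • (resolvent T z * G * resolvent T z))

/-- `(1 / 2πi) ∫_Γ φ(z) R(z, T) (G R(z, T))² dz`. -/
def secondOrderTerm {Ω : Set ℂ} (Γ : SmoothBoundary Ω) (φ : ℂ → ℂ) (T G : H →L[ℂ] H) :
    H →L[ℂ] H :=
  (2 * Real.pi * Complex.I : ℂ)⁻¹ •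
    contourIntegral Γ.γ (fun z => φ z • (resolvent T z * (G * resolvent T z) ^ 2))

/-- `T = ∑ i, lam i • P i`, with real `lam i` (repeated according to multiplicity) and mutually
orthogonal one-dimensional orthogonal projections `P i` that add up to the identity. The indices
with `lam i = 0` exhaust the kernel of `T`. Both series converge pointwise on `H`. -/
structure IsEigenExpansion {ι : Type*} (T : H →L[ℂ] H) (lam : ι → ℝ) (P : ι → H →L[ℂ] H) :
    Prop where
  isStarProjection : ∀ i, IsStarProjection (P i)
  finrank_range : ∀ i, Module.finrank ℂ (P i).range = 1
  orthogonal : Pairwise fun i j => P i * P j = 0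
  complete : ∀ x, HasSum (fun i => P i x) x
  expansion : ∀ x, HasSum (fun i => (lam i : ℂ) • P i x) (T x)

/-- `S = ∑_{i,k} a i k` in the strong operator topology: the partial sums over the finite boxes
`F₁ × F₂` converge pointwise to `S` as `F₁` and `F₂` increase independently. -/
def HasStrongSum₂ {ι : Type*} (a : ι → ι → H →L[ℂ] H) (S : H →L[ℂ] H) : Prop :=
  ∀ x, Tendsto (fun F : Finset ι × Finset ι => ∑ i ∈ F.1, ∑ k ∈ F.2, a i k x)
    atTop (𝓝 (S x))

/-- `S = ∑_{i,j,k} a i j k` in the strong operator topology, with partial sums over the finite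
boxes `F₁ × F₂ × F₃`. -/
def HasStrongSum₃ {ι : Type*} (a : ι → ι → ι → H →L[ℂ] H) (S : H →L[ℂ] H) : Prop :=
  ∀ x, Tendsto (fun F : Finset ι × Finset ι × Finset ι =>
    ∑ i ∈ F.1, ∑ j ∈ F.2.1, ∑ k ∈ F.2.2, a i j k x) atTop (𝓝 (S x))

/-- The weight of a pair `(a, b)` of different numbers: `(φ(b) - φ(a)) / (b - a)`;
`0` for all other pairs. -/
def weightDistinct₂ (φ : ℂ → ℂ) (a b : ℝ) : ℂ :=
  if a ≠ b then (φ b - φ a) / (b - a) else 0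

/-- The weight of a pair `(a, a)`: the derivative `φ'(a)`; `0` for all other pairs. -/
def weightEqual₂ (φ : ℂ → ℂ) (a b : ℝ) : ℂ :=
  if a = b then deriv φ a else 0

/-- The weight of a triple of pairwise different numbers; `0` for all other triples. -/
def weightDistinct₃ (φ : ℂ → ℂ) (a b c : ℝ) : ℂ :=
  if a ≠ b ∧ b ≠ c ∧ c ≠ a then
    ((b - c) * φ a + (c - a) * φ b + (a - b) * φ c) /
      ((a : ℂ) ^ 2 * (b - c) + (b : ℂ) ^ 2 * (c - a) + (c : ℂ) ^ 2 * (a - b))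
  else 0

/-- The expression `(φ'(a) - (φ(a) - φ(b)) / (a - b)) / (a - b)`, for `a ≠ b`. -/
def confluent (φ : ℂ → ℂ) (a b : ℝ) : ℂ :=
  1 / ((a : ℂ) - b) * (deriv φ a - (φ a - φ b) / ((a : ℂ) - b))

/-- The weight of a triple of which exactly two entries coincide; `0` for all other triples. -/
def weightTwoEqual₃ (φ : ℂ → ℂ) (a b c : ℝ) : ℂ :=
  if a = b ∧ b ≠ c then confluent φ a c
  else if b = c ∧ c ≠ a then confluent φ b a
  else if c = a ∧ a ≠ b then confluent φ c b
  else 0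

/-- The weight of a triple `(a, a, a)`: half the second derivative; `0` for all other triples. -/
def weightAllEqual₃ (φ : ℂ → ℂ) (a b c : ℝ) : ℂ :=
  if a = b ∧ b = c then deriv (deriv φ) a / 2 else 0

end

end ResolventCalculus

open ResolventCalculus

/-! Differentiability comes from differentiating under the contour integral. The spectrum is upper
semicontinuous, so `Γ` stays in the resolvent set for all operators near `T`. The derivative of `A ↦
R(z, A)` is `G ↦ R G R`, and the product rule gives the second derivative `2 R G R G R` on the
diagonal.

For the series, `P i * R(z, T) = (z - lam i)⁻¹ • P i`, and likewise on the right, so compressing the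
derivative by the `P i` leaves scalar integrals of `φ` against products of two or three factors `(z
- a)⁻¹`. By Cauchy's formula these are iterated divided differences `dslope`. Cauchy's theorem for
the cycle `Γ` is obtained by Dixon's argument (`contourIntegral_dslope_left`), which needs only the
winding numbers. Sorting the divided differences by coincidences of their arguments gives the stated
weights (`dslope_eq_weight`, `dslope_dslope_eq_weight`).

The remaining difficulty is that each partial series, restricted to one pattern of coincidences, has
to converge strongly by itself. The restriction `lam i = lam k` on matrix entries is realised by a
bounded map, the pinching `blockDiagonal` along the eigenspaces of `T`. For triples, `sandwichTerm`
keeps the middle operator `X` and the outer operators `U`, `V` as separate variables: pinching `U`,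
pinching `V` or pinching the result imposes equality of the first two, the last two or the outer two
eigenvalues. Inclusion-exclusion then isolates every pattern. All the resulting maps of `X` are
strongly continuous along the bounded net of partial sums of the `P j`, so the sums over boxes
converge (`hasStrongSum₃`). -/

namespace ResolventCalculus

/-! ### Parameter integrals and regularity of divided differences. -/

open MeasureTheory in
/-- An integral over `[0, 1]` depends holomorphically on a complex parameter if the integrand is
jointly continuous and holomorphic in the parameter. -/
theorem differentiableOn_intervalIntegral {E : Type*} [NormedAddCommGroup E] [NormedSpace ℂ E]
    [CompleteSpace E] {U : Set ℂ} (hU : IsOpen U) {F : ℂ → ℝ → E}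
    (hF : ∀ w ∈ U, ∀ t, ContinuousAt (Function.uncurry F) (w, t))
    (hd : ∀ t, DifferentiableOn ℂ (fun w => F w t) U) :
    DifferentiableOn ℂ (fun w => ∫ t in (0 : ℝ)..1, F w t) U := by
  intro w₀ hw₀
  have hcont : ∀ w ∈ U, Continuous (F w) := fun w hw => continuous_iff_continuousAt.2 fun t =>
    (hF w hw t).comp (f := fun t : ℝ => (w, t)) (by fun_prop)
  obtain ⟨C, hC⟩ := isCompact_Icc.exists_bound_of_continuousOn (s := Set.Icc (0 : ℝ) 1)
    (hcont w₀ hw₀).continuousOn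
  have h1 : ∀ᶠ w in 𝓝 w₀, ∀ t ∈ Set.Icc (0 : ℝ) 1, ‖F w t‖ ≤ C + 1 := by
    refine isCompact_Icc.eventually_forall_of_forall_eventually fun t ht => ?_
    have := (hF w₀ hw₀ t).norm.eventually_lt_const
      (u := C + 1) (by have := hC t ht; simp only [Function.uncurry]; linarith)
    filter_upwards [this] with z hz using hz.le
  obtain ⟨r, hr, hrU⟩ := Metric.eventually_nhds_iff_ball.1 (h1.and (hU.mem_nhds hw₀))
  -- Cauchy's estimate on circles of radius `r / 4`: centred in the ball of radius `r / 2`, they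
  -- stay in the ball of radius `r` where the integrand is bounded by `C + 1`.
  have hderiv : ∀ t ∈ Set.Icc (0 : ℝ) 1, ∀ w ∈ Metric.ball w₀ (r / 2),
      ‖deriv (fun w => F w t) w‖ ≤ (C + 1) / (r / 4) := by
    intro t ht w hw
    have hsub : Metric.closedBall w (r / 4) ⊆ Metric.ball w₀ r := by
      intro z hz
      rw [Metric.mem_ball] at hw ⊢
      rw [Metric.mem_closedBall] at hz
      linarith [dist_triangle z w w₀]
    refine Complex.norm_deriv_le_of_forall_mem_sphere_norm_le (by positivity) ?_ ?_
    · refine DifferentiableOn.diffContOnCl ?_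
      rw [closure_ball _ (by positivity)]
      exact (hd t).mono fun z hz => (hrU z (hsub hz)).2
    · exact fun z hz => (hrU z (hsub (Metric.sphere_subset_closedBall hz))).1 t ht
  have hIoc : ∀ t ∈ Set.uIoc (0 : ℝ) 1, t ∈ Set.Icc (0 : ℝ) 1 := by
    intro t ht
    rw [Set.uIoc_of_le zero_le_one] at ht
    exact Set.Ioc_subset_Icc_self ht
  have hmeas : AEStronglyMeasurable (fun t => deriv (fun w => F w t) w₀)
      (volume.restrict (Set.uIoc (0 : ℝ) 1)) := by
    classical
    -- The derivative is a pointwise limit of difference quotients; the value `0` for `w ∉ U` makes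
    -- every approximant measurable.
    refine aestronglyMeasurable_of_tendsto_ae (𝓝[≠] w₀)
      (f := fun w t => if w ∈ U then (w - w₀)⁻¹ • (F w t - F w₀ t) else 0) (fun w => ?_)
      (Eventually.of_forall fun t => ?_)
    · by_cases hw : w ∈ U
      · simp only [hw, if_true]
        exact (((hcont w hw).sub (hcont w₀ hw₀)).const_smul _).aestronglyMeasurable
      · simp only [hw, if_false]
        exact aestronglyMeasurable_const
    · have := (((hd t).differentiableAt (hU.mem_nhds hw₀)).hasDerivAt).tendsto_slope
      refine this.congr' ?_
      filter_upwards [nhdsWithin_le_nhds (hU.mem_nhds hw₀)] with w hw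
      simp [hw, slope]
  exact ((intervalIntegral.hasDerivAt_integral_of_dominated_loc_of_deriv_le
    (F' := fun w t => deriv (fun w => F w t) w) (bound := fun _ => (C + 1) / (r / 4))
    (Metric.ball_mem_nhds w₀ (half_pos hr))
    (by filter_upwards [hU.mem_nhds hw₀] with w hw using (hcont w hw).aestronglyMeasurable)
    ((hcont w₀ hw₀).intervalIntegrable _ _) hmeas
    (Eventually.of_forall fun t ht => hderiv t (hIoc t ht))
    intervalIntegrable_const
    (Eventually.of_forall fun t _ w hw => ((hd t).differentiableAt (hU.mem_nhds
      (hrU w (Metric.ball_subset_ball (by linarith) hw)).2)).hasDerivAt)).2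
    ).differentiableAt.differentiableWithinAt

/-- The divided difference of an analytic function is continuous in both variables. -/
theorem continuousAt_dslope_prod {φ : ℂ → ℂ} {a b : ℂ} (ha : AnalyticAt ℂ φ a)
    (hb : AnalyticAt ℂ φ b) : ContinuousAt (fun p : ℂ × ℂ => dslope φ p.1 p.2) (a, b) := by
  rcases eq_or_ne b a with rfl | hne
  · rw [ContinuousAt, Metric.tendsto_nhds]
    intro ε hε
    -- Near a diagonal point, strict differentiability controls the quotients at pairs of different
    -- points, and continuity of the derivative controls the pairs on the diagonal.
    have h1 := ha.hasStrictDerivAt.hasStrictFDerivAt.isLittleO.def (half_pos hε)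
    have h2 := (Metric.tendsto_nhds.1 (ha.deriv.continuousAt.comp (f := Prod.fst)
      (x := ((b, b) : ℂ × ℂ)) continuousAt_fst)) (ε / 2) (half_pos hε)
    filter_upwards [h1, h2] with p hp1 hp2
    rcases eq_or_ne p.2 p.1 with h | h
    · simp only [h, dslope_same]
      exact hp2.trans (half_lt_self hε)
    · simp only [dslope_same, dslope_of_ne _ h, slope_def_field, dist_eq_norm]
      have hne : p.1 - p.2 ≠ 0 := sub_ne_zero.2 h.symm
      have hpos : 0 < ‖p.1 - p.2‖ := norm_pos_iff.2 hne
      have : (φ p.2 - φ p.1) / (p.2 - p.1) - deriv φ b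
          = (φ p.1 - φ p.2 - (p.1 - p.2) * deriv φ b) / (p.1 - p.2) := by
        have : p.2 - p.1 ≠ 0 := sub_ne_zero.2 h
        field_simp
        ring
      rw [this, norm_div]
      refine lt_of_le_of_lt ?_ (half_lt_self hε)
      rw [div_le_iff₀ hpos]
      simpa using hp1
  · have h1 : ContinuousAt (fun p : ℂ × ℂ => (φ p.2 - φ p.1) / (p.2 - p.1)) (a, b) := by
      refine ContinuousAt.div ?_ (by fun_prop) (sub_ne_zero.2 hne)
      exact (ContinuousAt.comp (f := Prod.snd) (x := (a, b)) hb.continuousAt continuousAt_snd).sub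
        (ContinuousAt.comp (f := Prod.fst) (x := (a, b)) ha.continuousAt continuousAt_fst)
    refine h1.congr ?_
    have : ∀ᶠ p : ℂ × ℂ in 𝓝 (a, b), p.2 ≠ p.1 :=
      (isOpen_ne_fun continuous_snd continuous_fst).mem_nhds hne
    filter_upwards [this] with p hp
    rw [dslope_of_ne _ hp, slope_def_field]

theorem analyticOnNhd_dslope {φ : ℂ → ℂ} {D : Set ℂ} (hD : IsOpen D) (hφ : AnalyticOnNhd ℂ φ D)
    {a : ℂ} (ha : a ∈ D) : AnalyticOnNhd ℂ (dslope φ a) D :=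
  ((Complex.differentiableOn_dslope (hD.mem_nhds ha)).2 hφ.differentiableOn).analyticOnNhd hD

/-! ### Contour integrals over the boundary and Cauchy's theorem. -/

namespace SmoothBoundary

variable {Ω : Set ℂ} (Γ : SmoothBoundary Ω)
variable {E : Type*} [NormedAddCommGroup E] [NormedSpace ℂ E]

theorem mem_frontier (k : Fin Γ.n) (t : ℝ) : Γ.γ k t ∈ frontier Ω := by
  rw [← Γ.iUnion_range]
  exact Set.mem_iUnion_of_mem k (Set.mem_range_self t)

theorem continuous_γ (k : Fin Γ.n) : Continuous (Γ.γ k) := (Γ.contDiff k).continuous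

theorem continuous_deriv (k : Fin Γ.n) : Continuous (deriv (Γ.γ k)) :=
  (Γ.contDiff k).continuous_deriv le_rfl

theorem hasDerivAt (k : Fin Γ.n) (t : ℝ) : HasDerivAt (Γ.γ k) (deriv (Γ.γ k) t) t :=
  ((Γ.contDiff k).differentiable one_ne_zero t).hasDerivAt

theorem continuous_comp {F : Type*} [TopologicalSpace F] {f : ℂ → F}
    (hf : ContinuousOn f (frontier Ω)) (k : Fin Γ.n) :
    Continuous fun t => f (Γ.γ k t) :=
  hf.comp_continuous (Γ.continuous_γ k) (Γ.mem_frontier k)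

theorem continuous_integrand {f : ℂ → E} (hf : ContinuousOn f (frontier Ω)) (k : Fin Γ.n) :
    Continuous fun t => deriv (Γ.γ k) t • f (Γ.γ k t) :=
  (Γ.continuous_deriv k).smul (Γ.continuous_comp hf k)

theorem contourIntegral_congr {f g : ℂ → E} (h : Set.EqOn f g (frontier Ω)) :
    contourIntegral Γ.γ f = contourIntegral Γ.γ g := by
  simp only [contourIntegral]
  exact Finset.sum_congr rfl fun k _ => by simp only [h (Γ.mem_frontier k _)]

theorem contourIntegral_add {f g : ℂ → E} (hf : ContinuousOn f (frontier Ω))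
    (hg : ContinuousOn g (frontier Ω)) :
    contourIntegral Γ.γ (fun z => f z + g z) = contourIntegral Γ.γ f + contourIntegral Γ.γ g := by
  simp only [contourIntegral, smul_add, ← Finset.sum_add_distrib]
  exact Finset.sum_congr rfl fun k _ => intervalIntegral.integral_add
    ((Γ.continuous_integrand hf k).intervalIntegrable _ _)
    ((Γ.continuous_integrand hg k).intervalIntegrable _ _)

theorem contourIntegral_const_mul (c : ℂ) (f : ℂ → ℂ) :
    contourIntegral Γ.γ (fun z => c * f z) = c * contourIntegral Γ.γ f := by
  simp only [contourIntegral, Finset.mul_sum, smul_eq_mul, ← intervalIntegral.integral_const_mul,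
    mul_left_comm]

theorem map_contourIntegral {F : Type*} [NormedAddCommGroup F] [NormedSpace ℂ F] [CompleteSpace E]
    [CompleteSpace F] (L : E →L[ℂ] F) {f : ℂ → E} (hf : ContinuousOn f (frontier Ω)) :
    L (contourIntegral Γ.γ f) = contourIntegral Γ.γ (fun z => L (f z)) := by
  simp only [contourIntegral, map_sum, ← map_smul]
  exact Finset.sum_congr rfl fun k _ => (L.intervalIntegral_comp_comm
    ((Γ.continuous_integrand hf k).intervalIntegrable _ _)).symm

theorem contourIntegral_smul_const [CompleteSpace E] {f : ℂ → ℂ} (hf : ContinuousOn f (frontier Ω))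
    (v : E) : contourIntegral Γ.γ (fun z => f z • v) = contourIntegral Γ.γ f • v := by
  have := Γ.map_contourIntegral ((ContinuousLinearMap.id ℂ ℂ).smulRight v) hf
  simpa using this.symm

theorem ne_of_mem_frontier (hΩo : IsOpen Ω) {a z : ℂ} (ha : a ∈ Ω) (hz : z ∈ frontier Ω) :
    z ≠ a := by
  rintro rfl
  rw [hΩo.frontier_eq] at hz
  exact hz.2 ha

theorem continuousOn_inv_sub (hΩo : IsOpen Ω) {a : ℂ} (ha : a ∈ Ω) :
    ContinuousOn (fun z : ℂ => (z - a)⁻¹) (frontier Ω) :=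
  ContinuousOn.inv₀ (by fun_prop) fun _ hz => sub_ne_zero.2 (ne_of_mem_frontier hΩo ha hz)

/-- The integral of a derivative along closed curves vanishes. -/
theorem contourIntegral_eq_zero_of_hasDerivAt {f g : ℂ → ℂ}
    (hf : ContinuousOn f (frontier Ω)) (h : ∀ z ∈ frontier Ω, HasDerivAt g (f z) z) :
    contourIntegral Γ.γ f = 0 := by
  refine Finset.sum_eq_zero fun k _ => ?_
  rw [intervalIntegral.integral_eq_sub_of_hasDerivAt (f := fun t => g (Γ.γ k t))]
  · have := Γ.periodic k 0
    rw [zero_add] at this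
    simp only [this, sub_self]
  · intro t _
    have := (h _ (Γ.mem_frontier k t)).scomp t (Γ.hasDerivAt k t)
    exact this
  · exact (Γ.continuous_integrand hf k).intervalIntegrable _ _

/-- Dixon's form of Cauchy's theorem: the divided differences of an analytic function integrate
to `0` over the boundary. -/
theorem contourIntegral_dslope_left (hΩb : Bornology.IsBounded Ω)
    {D : Set ℂ} (hD : IsOpen D) (hΩD : closure Ω ⊆ D) {φ : ℂ → ℂ} (hφ : AnalyticOnNhd ℂ φ D)
    {w : ℂ} (hw : w ∈ D) : contourIntegral Γ.γ (dslope φ w) = 0 := by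
  classical
  have hfr : frontier Ω ⊆ closure Ω := frontier_subset_closure
  have hφc : ContinuousOn φ (frontier Ω) := hφ.continuousOn.mono (hfr.trans hΩD)
  set h1 : ℂ → ℂ := fun w => contourIntegral Γ.γ (dslope φ w) with h1_def
  set h2 : ℂ → ℂ := fun w => contourIntegral Γ.γ (fun z => (z - w)⁻¹ * φ z) with h2_def
  have d1 : DifferentiableOn ℂ h1 D := by
    refine DifferentiableOn.fun_sum fun k _ => differentiableOn_intervalIntegral hD ?_ ?_
    · intro w hw t
      refine ContinuousAt.smul (f := fun p : ℂ × ℝ => deriv (Γ.γ k) p.2)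
        (g := fun p : ℂ × ℝ => dslope φ p.1 (Γ.γ k p.2)) ?_ ?_
      · exact ((Γ.continuous_deriv k).comp continuous_snd).continuousAt
      · exact ContinuousAt.comp (g := fun p : ℂ × ℂ => dslope φ p.1 p.2)
          (f := fun p : ℂ × ℝ => (p.1, Γ.γ k p.2))
          (continuousAt_dslope_prod (hφ w hw) (hφ _ (hΩD (hfr (Γ.mem_frontier k t)))))
          (by have := Γ.continuous_γ k; fun_prop)
    · intro t
      have hz := hΩD (hfr (Γ.mem_frontier k t))
      refine DifferentiableOn.const_smul (c := deriv (Γ.γ k) t)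
        (f := fun w => dslope φ w (Γ.γ k t)) ?_
      -- The divided difference is symmetric, so holomorphy in the base point follows from
      -- holomorphy in the other argument.
      refine ((analyticOnNhd_dslope hD hφ hz).differentiableOn).congr fun w _ => ?_
      rcases eq_or_ne w (Γ.γ k t) with rfl | hne
      · rfl
      · rw [dslope_of_ne _ hne, dslope_of_ne _ hne.symm, slope_comm]
  have d2 : DifferentiableOn ℂ h2 (closure Ω)ᶜ := by
    have hne : ∀ w ∈ (closure Ω)ᶜ, ∀ (k : Fin Γ.n) t, Γ.γ k t - w ≠ 0 := fun w hw k t =>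
      sub_ne_zero.2 fun h => hw (h ▸ hfr (Γ.mem_frontier k t))
    refine DifferentiableOn.fun_sum fun k _ =>
      differentiableOn_intervalIntegral isClosed_closure.isOpen_compl ?_ ?_
    · intro w hw t
      refine ContinuousAt.smul (f := fun p : ℂ × ℝ => deriv (Γ.γ k) p.2)
        (g := fun p : ℂ × ℝ => (Γ.γ k p.2 - p.1)⁻¹ * φ (Γ.γ k p.2)) ?_ ?_
      · exact ((Γ.continuous_deriv k).comp continuous_snd).continuousAt
      · refine ContinuousAt.mul (ContinuousAt.inv₀ ?_ (hne w hw k t)) ?_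
        · have := Γ.continuous_γ k
          fun_prop
        · exact ((Γ.continuous_comp hφc k).comp continuous_snd).continuousAt
    · intro t
      refine DifferentiableOn.const_smul (c := deriv (Γ.γ k) t)
        (f := fun w => (Γ.γ k t - w)⁻¹ * φ (Γ.γ k t)) ?_
      exact (DifferentiableOn.inv (by fun_prop) fun w hw => hne w hw k t).mul_const _
  -- Off `closure Ω` the divided difference splits into two integrable terms, and the one carrying
  -- `φ w` is a multiple of a winding number equal to `0`.
  have agree : ∀ w ∈ D, w ∉ closure Ω → h1 w = h2 w := by
    intro w _ hwc
    have hne : ∀ z ∈ frontier Ω, z - w ≠ 0 := fun z hz =>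
      sub_ne_zero.2 fun h => hwc (h ▸ hfr hz)
    have hinv : ContinuousOn (fun z : ℂ => (z - w)⁻¹) (frontier Ω) :=
      ContinuousOn.inv₀ (by fun_prop) hne
    have : h1 w = contourIntegral Γ.γ (fun z => (z - w)⁻¹ * φ z + (-φ w) * (z - w)⁻¹) := by
      refine Γ.contourIntegral_congr fun z hz => ?_
      rw [dslope_of_ne _ (sub_ne_zero.1 (hne z hz)), slope_def_field]
      ring
    rw [this, Γ.contourIntegral_add (f := fun z => (z - w)⁻¹ * φ z)
      (g := fun z => (-φ w) * (z - w)⁻¹) (hinv.mul hφc) (continuousOn_const.mul hinv),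
      Γ.contourIntegral_const_mul, Γ.winding_outside w hwc, mul_zero, add_zero]
  -- As `closure Ω ⊆ D`, the open sets `D` and `(closure Ω)ᶜ` cover the plane, so the glued function
  -- is entire. It tends to `0` at infinity, hence vanishes by Liouville.
  set h : ℂ → ℂ := fun w => if w ∈ D then h1 w else h2 w with h_def
  have hd : Differentiable ℂ h := by
    intro w
    by_cases hw : w ∈ D
    · refine (d1.differentiableAt (hD.mem_nhds hw)).congr_of_eventuallyEq ?_
      filter_upwards [hD.mem_nhds hw] with z hz
      simp [h_def, hz]
    · have hwc : (closure Ω)ᶜ ∈ 𝓝 w :=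
        isClosed_closure.isOpen_compl.mem_nhds fun h => hw (hΩD h)
      refine (d2.differentiableAt hwc).congr_of_eventuallyEq ?_
      filter_upwards [hwc] with z hz
      by_cases hzD : z ∈ D
      · simp [h_def, hzD, agree z hzD hz]
      · simp [h_def, hzD]
  have ev : h =ᶠ[cocompact ℂ] h2 := by
    filter_upwards [hΩb.isCompact_closure.compl_mem_cocompact] with z hz
    by_cases hzD : z ∈ D
    · simp [h_def, hzD, agree z hzD hz]
    · simp [h_def, hzD]
  have lim : Tendsto h (cocompact ℂ) (𝓝 0) := by
    refine Tendsto.congr' ev.symm ?_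
    have : (0 : ℂ) = ∑ k : Fin Γ.n, 0 := by simp
    rw [this]
    refine tendsto_finsetSum _ fun k _ => ?_
    obtain ⟨R, hR⟩ := hΩb.isCompact_closure.isBounded.exists_norm_le
    obtain ⟨C, hC⟩ := isCompact_Icc.exists_bound_of_continuousOn (s := Set.Icc (0 : ℝ) 1)
      (Γ.continuous_integrand hφc k).continuousOn
    have hlim : Tendsto (fun w : ℂ => C / (‖w‖ - R)) (cocompact ℂ) (𝓝 0) :=
      (tendsto_const_nhds (x := C)).div_atTop
        (tendsto_atTop_add_const_right _ (-R) (tendsto_norm_cocompact_atTop (E := ℂ)))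
    refine squeeze_zero_norm' ?_ hlim
    filter_upwards [(tendsto_norm_cocompact_atTop (E := ℂ)).eventually_gt_atTop R] with w hw
    have hwR : 0 < ‖w‖ - R := sub_pos.2 hw
    refine (intervalIntegral.norm_integral_le_of_norm_le_const (C := C / (‖w‖ - R)) ?_).trans
      (by simp)
    intro t ht
    rw [Set.uIoc_of_le zero_le_one] at ht
    have h1 := hC t (Set.Ioc_subset_Icc_self ht)
    have h2 : ‖w‖ - R ≤ ‖Γ.γ k t - w‖ := by
      have := hR _ (hfr (Γ.mem_frontier k t))
      have := norm_sub_norm_le w (Γ.γ k t)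
      rw [norm_sub_rev] at this
      linarith
    have : deriv (Γ.γ k) t • ((Γ.γ k t - w)⁻¹ * φ (Γ.γ k t))
        = (deriv (Γ.γ k) t • φ (Γ.γ k t)) / (Γ.γ k t - w) := by
      simp only [smul_eq_mul]
      ring
    rw [this, norm_div]
    exact div_le_div₀ ((norm_nonneg _).trans h1) h1 hwR h2
  have := hd.apply_eq_of_tendsto_cocompact w lim
  simpa [h_def, hw] using this

end SmoothBoundary

end ResolventCalculus

/-! ### Cauchy's formula for divided differences. -/

namespace ResolventCalculus

namespace SmoothBoundary

variable {Ω : Set ℂ} (Γ : SmoothBoundary Ω)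

/-- For `a = b` there is a single-valued antiderivative. For `a ≠ b`, partial fractions leave the
difference of two winding integrals, both `2πi`. This removes the remainder in
`cauchy_formula_dslope`. -/
theorem contourIntegral_inv_mul_inv (hΩo : IsOpen Ω) {a b : ℂ} (ha : a ∈ Ω) (hb : b ∈ Ω) :
    contourIntegral Γ.γ (fun z => (z - a)⁻¹ * (z - b)⁻¹) = 0 := by
  have ca := continuousOn_inv_sub hΩo ha
  have cb := continuousOn_inv_sub hΩo hb
  rcases eq_or_ne a b with rfl | hab
  · refine Γ.contourIntegral_eq_zero_of_hasDerivAt (g := fun z => -(z - a)⁻¹) (ca.mul ca)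
      fun z hz => ?_
    have h0 := sub_ne_zero.2 (ne_of_mem_frontier hΩo ha hz)
    refine (((hasDerivAt_id' z).sub_const a).fun_inv h0).fun_neg.congr_deriv ?_
    field_simp
  · have h : contourIntegral Γ.γ (fun z => (z - a)⁻¹ * (z - b)⁻¹) = contourIntegral Γ.γ
        (fun z => (a - b)⁻¹ * (z - a)⁻¹ + (-(a - b)⁻¹) * (z - b)⁻¹) := by
      refine Γ.contourIntegral_congr fun z hz => ?_
      have h0 := sub_ne_zero.2 (ne_of_mem_frontier hΩo ha hz)
      have h1 := sub_ne_zero.2 (ne_of_mem_frontier hΩo hb hz)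
      have h2 := sub_ne_zero.2 hab
      field_simp
      ring
    rw [h, Γ.contourIntegral_add (f := fun z => (a - b)⁻¹ * (z - a)⁻¹)
      (g := fun z => (-(a - b)⁻¹) * (z - b)⁻¹) (continuousOn_const.mul ca)
      (continuousOn_const.mul cb), Γ.contourIntegral_const_mul, Γ.contourIntegral_const_mul,
      Γ.winding_inside a ha, Γ.winding_inside b hb]
    ring

theorem contourIntegral_inv_mul_inv_mul_inv_of_ne (hΩo : IsOpen Ω) {a b c : ℂ} (ha : a ∈ Ω)
    (hb : b ∈ Ω) (hc : c ∈ Ω) (hab : a ≠ b) :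
    contourIntegral Γ.γ (fun z => (z - a)⁻¹ * (z - b)⁻¹ * (z - c)⁻¹) = 0 := by
  have ca := continuousOn_inv_sub hΩo ha
  have cb := continuousOn_inv_sub hΩo hb
  have cc := continuousOn_inv_sub hΩo hc
  have h : contourIntegral Γ.γ (fun z => (z - a)⁻¹ * (z - b)⁻¹ * (z - c)⁻¹) =
      contourIntegral Γ.γ (fun z => (a - b)⁻¹ * ((z - a)⁻¹ * (z - c)⁻¹) +
        (-(a - b)⁻¹) * ((z - b)⁻¹ * (z - c)⁻¹)) := by
    refine Γ.contourIntegral_congr fun z hz => ?_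
    have h0 := sub_ne_zero.2 (ne_of_mem_frontier hΩo ha hz)
    have h1 := sub_ne_zero.2 (ne_of_mem_frontier hΩo hb hz)
    have h3 := sub_ne_zero.2 (ne_of_mem_frontier hΩo hc hz)
    have h2 := sub_ne_zero.2 hab
    field_simp
    ring
  rw [h, Γ.contourIntegral_add (f := fun z => (a - b)⁻¹ * ((z - a)⁻¹ * (z - c)⁻¹))
    (g := fun z => (-(a - b)⁻¹) * ((z - b)⁻¹ * (z - c)⁻¹)) (continuousOn_const.mul (ca.mul cc))
    (continuousOn_const.mul (cb.mul cc)), Γ.contourIntegral_const_mul,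
    Γ.contourIntegral_const_mul, Γ.contourIntegral_inv_mul_inv hΩo ha hc,
    Γ.contourIntegral_inv_mul_inv hΩo hb hc]
  ring

/-- As soon as two adjacent points differ, partial fractions reduce to products of two factors; a
triple pole has an antiderivative. -/
theorem contourIntegral_inv_mul_inv_mul_inv (hΩo : IsOpen Ω) {a b c : ℂ} (ha : a ∈ Ω)
    (hb : b ∈ Ω) (hc : c ∈ Ω) :
    contourIntegral Γ.γ (fun z => (z - a)⁻¹ * (z - b)⁻¹ * (z - c)⁻¹) = 0 := by
  by_cases hab : a = b
  · by_cases hbc : b = c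
    · subst hab hbc
      have ca := continuousOn_inv_sub hΩo ha
      refine Γ.contourIntegral_eq_zero_of_hasDerivAt (g := fun z => -(1 / 2) * ((z - a) ^ 2)⁻¹)
        ((ca.mul ca).mul ca) fun z hz => ?_
      have h0 := sub_ne_zero.2 (ne_of_mem_frontier hΩo ha hz)
      refine ((((((hasDerivAt_id' z).sub_const a).fun_pow 2).fun_inv (pow_ne_zero 2 h0)).const_mul
        (-(1 / 2) : ℂ))).congr_deriv ?_
      field_simp
      norm_num
    · rw [← Γ.contourIntegral_inv_mul_inv_mul_inv_of_ne hΩo hb hc ha hbc]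
      exact Γ.contourIntegral_congr fun z _ => by ring
  · exact Γ.contourIntegral_inv_mul_inv_mul_inv_of_ne hΩo ha hb hc hab

variable {D : Set ℂ} {φ : ℂ → ℂ}

/-- Cauchy's integral formula. -/
theorem cauchy_formula (hΩo : IsOpen Ω) (hΩb : Bornology.IsBounded Ω) (hD : IsOpen D)
    (hΩD : closure Ω ⊆ D) (hφ : AnalyticOnNhd ℂ φ D) {a : ℂ} (ha : a ∈ Ω) :
    contourIntegral Γ.γ (fun z => φ z * (z - a)⁻¹) = 2 * Real.pi * Complex.I * φ a := by
  have haD := hΩD (subset_closure ha)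
  have h : contourIntegral Γ.γ (fun z => φ z * (z - a)⁻¹) =
      contourIntegral Γ.γ (fun z => dslope φ a z + φ a * (z - a)⁻¹) := by
    refine Γ.contourIntegral_congr fun z hz => ?_
    rw [dslope_of_ne _ (ne_of_mem_frontier hΩo ha hz), slope_def_field]
    ring
  rw [h, Γ.contourIntegral_add (f := dslope φ a) (g := fun z => φ a * (z - a)⁻¹)
    ((analyticOnNhd_dslope hD hφ haD).continuousOn.mono (frontier_subset_closure.trans hΩD))
    (continuousOn_const.mul (continuousOn_inv_sub hΩo ha)),
    Γ.contourIntegral_dslope_left hΩb hD hΩD hφ haD, Γ.contourIntegral_const_mul,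
    Γ.winding_inside a ha]
  ring

/-- Cauchy's integral formula for divided differences of first order. -/
theorem cauchy_formula_dslope (hΩo : IsOpen Ω) (hΩb : Bornology.IsBounded Ω) (hD : IsOpen D)
    (hΩD : closure Ω ⊆ D) (hφ : AnalyticOnNhd ℂ φ D) {a b : ℂ} (ha : a ∈ Ω) (hb : b ∈ Ω) :
    contourIntegral Γ.γ (fun z => φ z * ((z - a)⁻¹ * (z - b)⁻¹)) =
      2 * Real.pi * Complex.I * dslope φ a b := by
  have haD := hΩD (subset_closure ha)
  have hψ := analyticOnNhd_dslope hD hφ haD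
  have ca := continuousOn_inv_sub hΩo ha
  have cb := continuousOn_inv_sub hΩo hb
  -- Replacing `φ z / (z - a)` by `dslope φ a z + φ a / (z - a)` trades one pole for one divided
  -- difference; the same device lowers the order in the next formula.
  have h : contourIntegral Γ.γ (fun z => φ z * ((z - a)⁻¹ * (z - b)⁻¹)) = contourIntegral Γ.γ
      (fun z => dslope φ a z * (z - b)⁻¹ + φ a * ((z - a)⁻¹ * (z - b)⁻¹)) := by
    refine Γ.contourIntegral_congr fun z hz => ?_
    rw [dslope_of_ne _ (ne_of_mem_frontier hΩo ha hz), slope_def_field]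
    ring
  rw [h, Γ.contourIntegral_add (f := fun z => dslope φ a z * (z - b)⁻¹)
    (g := fun z => φ a * ((z - a)⁻¹ * (z - b)⁻¹))
    ((hψ.continuousOn.mono (frontier_subset_closure.trans hΩD)).mul cb)
    (continuousOn_const.mul (ca.mul cb)), Γ.cauchy_formula hΩo hΩb hD hΩD hψ hb,
    Γ.contourIntegral_const_mul, Γ.contourIntegral_inv_mul_inv hΩo ha hb]
  ring

/-- Cauchy's integral formula for divided differences of second order. -/
theorem cauchy_formula_dslope_dslope (hΩo : IsOpen Ω) (hΩb : Bornology.IsBounded Ω)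
    (hD : IsOpen D) (hΩD : closure Ω ⊆ D) (hφ : AnalyticOnNhd ℂ φ D) {a b c : ℂ} (ha : a ∈ Ω)
    (hb : b ∈ Ω) (hc : c ∈ Ω) :
    contourIntegral Γ.γ (fun z => φ z * ((z - a)⁻¹ * (z - b)⁻¹ * (z - c)⁻¹)) =
      2 * Real.pi * Complex.I * dslope (dslope φ a) b c := by
  have haD := hΩD (subset_closure ha)
  have hψ := analyticOnNhd_dslope hD hφ haD
  have ca := continuousOn_inv_sub hΩo ha
  have cb := continuousOn_inv_sub hΩo hb
  have cc := continuousOn_inv_sub hΩo hc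
  have h : contourIntegral Γ.γ (fun z => φ z * ((z - a)⁻¹ * (z - b)⁻¹ * (z - c)⁻¹)) =
      contourIntegral Γ.γ (fun z => dslope φ a z * ((z - b)⁻¹ * (z - c)⁻¹) +
        φ a * ((z - a)⁻¹ * (z - b)⁻¹ * (z - c)⁻¹)) := by
    refine Γ.contourIntegral_congr fun z hz => ?_
    rw [dslope_of_ne _ (ne_of_mem_frontier hΩo ha hz), slope_def_field]
    ring
  rw [h, Γ.contourIntegral_add (f := fun z => dslope φ a z * ((z - b)⁻¹ * (z - c)⁻¹))
    (g := fun z => φ a * ((z - a)⁻¹ * (z - b)⁻¹ * (z - c)⁻¹))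
    ((hψ.continuousOn.mono (frontier_subset_closure.trans hΩD)).mul (cb.mul cc))
    (continuousOn_const.mul ((ca.mul cb).mul cc)),
    Γ.cauchy_formula_dslope hΩo hΩb hD hΩD hψ hb hc,
    Γ.contourIntegral_const_mul, Γ.contourIntegral_inv_mul_inv_mul_inv hΩo ha hb hc]
  ring

end SmoothBoundary

/-! ### Divided differences expressed through the weights. -/

/-- Passing to the divided difference shifts the power series at `a` by one place, so its linear
coefficient is the quadratic coefficient of `φ`. -/
theorem deriv_dslope_same {φ : ℂ → ℂ} {a : ℂ} (h : AnalyticAt ℂ φ a) :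
    deriv (dslope φ a) a = deriv (deriv φ) a / 2 := by
  obtain ⟨p, r, hp⟩ := h
  have h1 := hp.hasFPowerSeriesAt.has_fpower_series_dslope_fslope.deriv
  have h2 := hp.factorial_smul (1 : ℂ) 2
  rw [iteratedFDeriv_apply_eq_iteratedDeriv_mul_prod, iteratedDeriv_succ, iteratedDeriv_one] at h2
  simp [Nat.factorial] at h1 h2
  rw [h1, ← h2]
  ring

theorem deriv_dslope_of_ne {φ : ℂ → ℂ} {a b : ℂ} (h : DifferentiableAt ℂ φ b) (hab : b ≠ a) :
    deriv (dslope φ a) b = (deriv φ b - (φ b - φ a) / (b - a)) / (b - a) := by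
  rw [(dslope_eventuallyEq_slope_of_ne φ hab).deriv_eq]
  have h0 := sub_ne_zero.2 hab
  have : slope φ a = fun z => (φ z - φ a) / (z - a) := by
    ext z
    rw [slope_def_field]
  rw [this, ((h.hasDerivAt.sub_const (φ a)).fun_div ((hasDerivAt_id' b).sub_const a) h0).deriv]
  field_simp

theorem dslope_eq_weight (φ : ℂ → ℂ) (a b : ℝ) :
    dslope φ a b = weightEqual₂ φ a b + weightDistinct₂ φ a b := by
  unfold weightEqual₂ weightDistinct₂
  by_cases h : a = b
  · subst h
    simp
  · have : (b : ℂ) ≠ a := by exact_mod_cast Ne.symm h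
    simp [h, dslope_of_ne _ this, slope_def_field]

theorem weightEqual₂_eq (φ : ℂ → ℂ) (a b : ℝ) :
    weightEqual₂ φ a b = if a = b then dslope φ a b else 0 := by
  unfold weightEqual₂
  split_ifs with h
  · subst h
    simp
  · rfl

theorem weightAllEqual₃_eq {φ : ℂ → ℂ} {a b c : ℝ} (ha : AnalyticAt ℂ φ a) :
    weightAllEqual₃ φ a b c = if a = b ∧ b = c then dslope (dslope φ a) b c else 0 := by
  unfold weightAllEqual₃
  split_ifs with h
  · obtain ⟨rfl, rfl⟩ := h
    rw [dslope_same, deriv_dslope_same ha]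
  · rfl

/-- Inclusion-exclusion: a triple with exactly two equal entries satisfies one of the three
equalities, a constant triple satisfies all three and is cancelled by the factor `3`. In this form
every restriction is an equality that a pinching can impose. -/
theorem weightTwoEqual₃_eq {φ : ℂ → ℂ} {a b c : ℝ}
    (hb : AnalyticAt ℂ φ b) :
    weightTwoEqual₃ φ a b c = (if a = b then dslope (dslope φ a) b c else 0)
      + (if b = c then dslope (dslope φ a) b c else 0)
      + (if a = c then dslope (dslope φ a) b c else 0)
      - 3 * (if a = b ∧ b = c then dslope (dslope φ a) b c else 0) := by
  unfold weightTwoEqual₃ confluent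
  by_cases hab : a = b
  · subst hab
    by_cases hac : a = c
    · subst hac
      simp
      ring
    · have h0 : (c : ℂ) ≠ a := by exact_mod_cast Ne.symm hac
      have h1 : (c : ℂ) - a ≠ 0 := sub_ne_zero.2 h0
      have h2 : (a : ℂ) - c ≠ 0 := sub_ne_zero.2 h0.symm
      simp [hac, dslope_of_ne _ h0, slope_def_field]
      field_simp
      ring
  · by_cases hbc : b = c
    · subst hbc
      have h0 : (b : ℂ) ≠ a := by exact_mod_cast Ne.symm hab
      have h1 : (b : ℂ) - a ≠ 0 := sub_ne_zero.2 h0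
      simp [hab, Ne.symm hab, deriv_dslope_of_ne hb.differentiableAt h0]
      field_simp
    · by_cases hac : a = c
      · subst hac
        have h0 : (b : ℂ) ≠ a := by exact_mod_cast Ne.symm hab
        have h1 : (b : ℂ) - a ≠ 0 := sub_ne_zero.2 h0
        have h2 : (a : ℂ) - b ≠ 0 := sub_ne_zero.2 h0.symm
        simp [hab, hbc, dslope_of_ne _ h0, dslope_of_ne _ h0.symm, slope_def_field]
        field_simp
        ring
      · simp [hab, hbc, hac, Ne.symm hac]

theorem dslope_dslope_eq_weight {φ : ℂ → ℂ} {a b c : ℝ} (ha : AnalyticAt ℂ φ a)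
    (hb : AnalyticAt ℂ φ b) :
    dslope (dslope φ a) b c =
      weightDistinct₃ φ a b c + weightTwoEqual₃ φ a b c + weightAllEqual₃ φ a b c := by
  rw [weightTwoEqual₃_eq hb, weightAllEqual₃_eq ha]
  unfold weightDistinct₃
  by_cases hab : a = b
  · subst hab
    by_cases hac : a = c
    · subst hac
      simp
      ring
    · simp [hac]
  · by_cases hbc : b = c
    · subst hbc
      simp [hab]
    · by_cases hac : a = c
      · subst hac
        simp [hab, hbc]
      · have h0 : (b : ℂ) - a ≠ 0 := sub_ne_zero.2 (by exact_mod_cast Ne.symm hab)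
        have h1 : (c : ℂ) - a ≠ 0 := sub_ne_zero.2 (by exact_mod_cast Ne.symm hac)
        have h2 : (c : ℂ) - b ≠ 0 := sub_ne_zero.2 (by exact_mod_cast Ne.symm hbc)
        -- The denominator is a Vandermonde determinant up to sign, hence nonzero at pairwise
        -- different points.
        have h3 : (a : ℂ) ^ 2 * (b - c) + (b : ℂ) ^ 2 * (c - a) + (c : ℂ) ^ 2 * (a - b)
            = (b - a) * (c - a) * (b - c) := by ring
        have h4 : (b : ℂ) - c ≠ 0 := by rw [← neg_sub]; exact neg_ne_zero.2 h2
        rw [h3, dslope_of_ne _ (sub_ne_zero.1 h2), slope_def_field,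
          dslope_of_ne _ (sub_ne_zero.1 h0), dslope_of_ne _ (sub_ne_zero.1 h1), slope_def_field,
          slope_def_field]
        simp [hab, hbc, hac, Ne.symm hac]
        field_simp
        ring

end ResolventCalculus

/-! ### Differentiation under the contour integral and derivatives of the resolvent. -/

namespace ResolventCalculus

open MeasureTheory in
theorem hasFDerivAt_intervalIntegral_of_continuousAt {X G : Type*} [NormedAddCommGroup X]
    [NormedSpace ℂ X] [NormedAddCommGroup G] [NormedSpace ℂ G]
    {U : Set X} {x₀ : X} (hU : U ∈ 𝓝 x₀) {f : X → ℝ → G} {f' : X → ℝ → X →L[ℂ] G}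
    (hf : ∀ x ∈ U, Continuous (f x)) (hf' : ∀ t, ContinuousAt (Function.uncurry f') (x₀, t))
    (hd : ∀ x ∈ U, ∀ t, HasFDerivAt (fun x => f x t) (f' x t) x) :
    HasFDerivAt (fun x => ∫ t in (0 : ℝ)..1, f x t) (∫ t in (0 : ℝ)..1, f' x₀ t) x₀ := by
  have hcont : Continuous (f' x₀) := continuous_iff_continuousAt.2 fun t =>
    (hf' t).comp (f := fun t : ℝ => (x₀, t)) (by fun_prop)
  obtain ⟨C, hC⟩ := isCompact_Icc.exists_bound_of_continuousOn (s := Set.Icc (0 : ℝ) 1)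
    hcont.continuousOn
  have h1 : ∀ᶠ x in 𝓝 x₀, ∀ t ∈ Set.Icc (0 : ℝ) 1, ‖f' x t‖ ≤ C + 1 := by
    refine isCompact_Icc.eventually_forall_of_forall_eventually fun t ht => ?_
    have := (hf' t).norm.eventually_lt_const
      (u := C + 1) (by have := hC t ht; simp only [Function.uncurry]; linarith)
    filter_upwards [this] with z hz using hz.le
  have hIoc : ∀ t ∈ Set.uIoc (0 : ℝ) 1, t ∈ Set.Icc (0 : ℝ) 1 := by
    intro t ht
    rw [Set.uIoc_of_le zero_le_one] at ht
    exact Set.Ioc_subset_Icc_self ht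
  exact intervalIntegral.hasFDerivAt_integral_of_dominated_of_fderiv_le
    (bound := fun _ => C + 1) (h1.and hU)
    (by filter_upwards [hU] with x hx using (hf x hx).aestronglyMeasurable)
    ((hf x₀ (mem_of_mem_nhds hU)).intervalIntegrable _ _) hcont.aestronglyMeasurable
    (Eventually.of_forall fun t ht x hx => hx.1 t (hIoc t ht)) intervalIntegrable_const
    (Eventually.of_forall fun t _ x hx => hd x hx.2 t)

/-- Differentiation under a contour integral. -/
theorem SmoothBoundary.hasFDerivAt_contourIntegral {Ω : Set ℂ} (Γ : SmoothBoundary Ω)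
    {X G : Type*} [NormedAddCommGroup X] [NormedSpace ℂ X] [NormedAddCommGroup G] [NormedSpace ℂ G]
    {U : Set X} {x₀ : X} (hU : U ∈ 𝓝 x₀) {f : X → ℂ → G} {f' : X → ℂ → X →L[ℂ] G}
    (hf : ∀ x ∈ U, ContinuousOn (f x) (frontier Ω))
    (hf' : ∀ z ∈ frontier Ω, ContinuousAt (Function.uncurry f') (x₀, z))
    (hd : ∀ x ∈ U, ∀ z ∈ frontier Ω, HasFDerivAt (fun x => f x z) (f' x z) x) :
    HasFDerivAt (fun x => contourIntegral Γ.γ (f x)) (contourIntegral Γ.γ (f' x₀)) x₀ := by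
  refine HasFDerivAt.fun_sum fun k _ => ?_
  refine hasFDerivAt_intervalIntegral_of_continuousAt hU
    (f' := fun x t => deriv (Γ.γ k) t • f' x (Γ.γ k t))
    (fun x hx => Γ.continuous_integrand (hf x hx) k) (fun t => ?_)
    (fun x hx t => (hd x hx _ (Γ.mem_frontier k t)).const_smul _)
  refine ContinuousAt.smul (f := fun p : X × ℝ => deriv (Γ.γ k) p.2)
    (g := fun p : X × ℝ => f' p.1 (Γ.γ k p.2)) ?_ ?_
  · exact ((Γ.continuous_deriv k).comp continuous_snd).continuousAt
  · refine ContinuousAt.comp (g := Function.uncurry f')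
      (f := fun p : X × ℝ => (p.1, Γ.γ k p.2)) (hf' _ (Γ.mem_frontier k t)) ?_
    have := Γ.continuous_γ k
    fun_prop

section BanachAlgebra

variable {𝔸 : Type*} [NormedRing 𝔸] [NormedAlgebra ℂ 𝔸]

theorem eventually_spectrum_subset [CompleteSpace 𝔸] {Ω : Set ℂ} (hΩ : IsOpen Ω) {A : 𝔸} (hA : spectrum ℂ A ⊆ Ω) :
    ∀ᶠ B in 𝓝 A, spectrum ℂ B ⊆ Ω := by
  have := upperHemicontinuous_spectrum ℂ 𝔸 A Ω (hΩ.mem_nhdsSet.2 hA)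
  filter_upwards [this] with B hB using subset_of_mem_nhdsSet hB

theorem isUnit_sub_of_mem_frontier {Ω : Set ℂ} (hΩ : IsOpen Ω) {A : 𝔸} (hA : spectrum ℂ A ⊆ Ω)
    {z : ℂ} (hz : z ∈ frontier Ω) : IsUnit (algebraMap ℂ 𝔸 z - A) := by
  rw [hΩ.frontier_eq] at hz
  by_contra h
  exact hz.2 (hA h)

theorem continuousAt_resolvent [CompleteSpace 𝔸] {A : 𝔸} {z : ℂ} (h : IsUnit (algebraMap ℂ 𝔸 z - A)) :
    ContinuousAt (fun p : 𝔸 × ℂ => resolvent p.1 p.2) (A, z) := by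
  obtain ⟨u, hu⟩ := h
  refine ContinuousAt.comp (g := Ring.inverse) (f := fun p : 𝔸 × ℂ => algebraMap ℂ 𝔸 p.2 - p.1)
    ?_ ?_
  · simp only
    rw [← hu]
    exact NormedRing.inverse_continuousAt u
  · have := algebraMapCLM ℂ 𝔸 |>.continuous
    exact ((this.comp continuous_snd).sub continuous_fst).continuousAt

/-- The minus sign in the derivative of inversion cancels the one from `A ↦ z - A`. -/
theorem hasFDerivAt_resolvent [CompleteSpace 𝔸] {A : 𝔸} {z : ℂ} (h : IsUnit (algebraMap ℂ 𝔸 z - A)) :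
    HasFDerivAt (fun A : 𝔸 => resolvent A z)
      (ContinuousLinearMap.mulLeftRight ℂ 𝔸 (resolvent A z) (resolvent A z)) A := by
  obtain ⟨u, hu⟩ := h
  have h1 := hasFDerivAt_ringInverse (𝕜 := ℂ) u
  rw [hu] at h1
  have h2 : HasFDerivAt (fun A : 𝔸 => algebraMap ℂ 𝔸 z - A) (-ContinuousLinearMap.id ℂ 𝔸) A :=
    (hasFDerivAt_id A).const_sub _
  have h3 := h1.comp A h2
  have hr : resolvent A z = ↑u⁻¹ := by rw [resolvent, ← hu, Ring.inverse_unit]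
  rw [hr]
  refine h3.congr_fderiv ?_
  ext x
  simp

theorem continuousOn_resolvent [CompleteSpace 𝔸] {Ω : Set ℂ} (hΩ : IsOpen Ω) {A : 𝔸} (hA : spectrum ℂ A ⊆ Ω) :
    ContinuousOn (fun z => resolvent A z) (frontier Ω) := fun _ hz =>
  ((continuousAt_resolvent (isUnit_sub_of_mem_frontier hΩ hA hz)).comp
    (f := fun z : ℂ => (A, z)) (by fun_prop)).continuousWithinAt

/-- The second derivative of `A ↦ R(z, A)`, as a function of the resolvent. -/
noncomputable def resolventSecondDeriv (R : 𝔸) : 𝔸 →L[ℂ] 𝔸 →L[ℂ] 𝔸 :=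
  let B := ContinuousLinearMap.mulLeftRight ℂ 𝔸
  B.precompR 𝔸 R (B R R) + B.precompL 𝔸 (B R R) R

/-- Differentiating `R G R` again in direction `G` hits the left or the right resolvent, and both
give `R G R G R`; hence the factor `2`. -/
theorem resolventSecondDeriv_apply (R G : 𝔸) :
    resolventSecondDeriv R G G = (2 : ℂ) • (R * (G * R) ^ 2) := by
  simp [resolventSecondDeriv, two_smul, pow_two, mul_assoc]

theorem continuous_resolventSecondDeriv :
    Continuous (resolventSecondDeriv : 𝔸 → 𝔸 →L[ℂ] 𝔸 →L[ℂ] 𝔸) := by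
  unfold resolventSecondDeriv
  fun_prop

end BanachAlgebra

variable {H : Type*} [NormedAddCommGroup H] [InnerProductSpace ℂ H] [CompleteSpace H]

/-! ### Fréchet derivatives of the functional calculus. -/

section Calculus

variable {Ω D : Set ℂ} (Γ : SmoothBoundary Ω) (hΩ : IsOpen Ω) (hΩD : closure Ω ⊆ D)
  {φ : ℂ → ℂ} (hφ : AnalyticOnNhd ℂ φ D)

include hΩ hΩD hφ

theorem hasFDerivAt_calculus {A : H →L[ℂ] H} (hA : spectrum ℂ A ⊆ Ω) :
    HasFDerivAt (calculus Γ φ : (H →L[ℂ] H) → H →L[ℂ] H)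
      ((2 * Real.pi * Complex.I : ℂ)⁻¹ • contourIntegral Γ.γ (fun z => φ z •
        ContinuousLinearMap.mulLeftRight ℂ (H →L[ℂ] H) (resolvent A z) (resolvent A z))) A := by
  have hfr := frontier_subset_closure.trans hΩD
  refine HasFDerivAt.const_smul (Γ.hasFDerivAt_contourIntegral
    (f := fun A z => φ z • resolvent A z)
    (f' := fun A z => φ z • ContinuousLinearMap.mulLeftRight ℂ (H →L[ℂ] H) (resolvent A z)
      (resolvent A z)) (eventually_spectrum_subset hΩ hA)
    (fun B hB => (hφ.continuousOn.mono hfr).smul (continuousOn_resolvent hΩ hB)) (fun z hz => ?_)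
    (fun B hB z hz => (hasFDerivAt_resolvent (isUnit_sub_of_mem_frontier hΩ hB hz)).fun_const_smul _))
    (2 * Real.pi * Complex.I : ℂ)⁻¹
  have h1 := continuousAt_resolvent (isUnit_sub_of_mem_frontier hΩ hA hz)
  refine ContinuousAt.smul (f := fun p : (H →L[ℂ] H) × ℂ => φ p.2)
    (g := fun p : (H →L[ℂ] H) × ℂ => ContinuousLinearMap.mulLeftRight ℂ (H →L[ℂ] H)
      (resolvent p.1 p.2) (resolvent p.1 p.2)) ?_ ?_
  · exact ContinuousAt.comp (f := Prod.snd) (x := (A, z)) (hφ z (hfr hz)).continuousAt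
      continuousAt_snd
  · exact (continuousAt_const.clm_apply h1).clm_apply h1

theorem hasFDerivAt_fderiv_calculus {A : H →L[ℂ] H} (hA : spectrum ℂ A ⊆ Ω) :
    HasFDerivAt (fderiv ℂ (calculus Γ φ : (H →L[ℂ] H) → H →L[ℂ] H))
      ((2 * Real.pi * Complex.I : ℂ)⁻¹ • contourIntegral Γ.γ (fun z => φ z •
        resolventSecondDeriv (resolvent A z))) A := by
  have hfr := frontier_subset_closure.trans hΩD
  have hc : ContinuousOn φ (frontier Ω) := hφ.continuousOn.mono hfr
  -- The integral formula for the first derivative holds on a whole neighbourhood of `A`, so it may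
  -- be differentiated once more.
  have hev : fderiv ℂ (calculus Γ φ : (H →L[ℂ] H) → H →L[ℂ] H) =ᶠ[𝓝 A] fun A =>
      (2 * Real.pi * Complex.I : ℂ)⁻¹ • contourIntegral Γ.γ (fun z => φ z •
        ContinuousLinearMap.mulLeftRight ℂ (H →L[ℂ] H) (resolvent A z) (resolvent A z)) := by
    filter_upwards [eventually_spectrum_subset hΩ hA] with B hB
    exact (hasFDerivAt_calculus Γ hΩ hΩD hφ hB).fderiv
  refine HasFDerivAt.congr_of_eventuallyEq ?_ hev
  refine HasFDerivAt.const_smul (Γ.hasFDerivAt_contourIntegral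
    (f := fun A z => φ z • ContinuousLinearMap.mulLeftRight ℂ (H →L[ℂ] H) (resolvent A z)
      (resolvent A z))
    (f' := fun A z => φ z • resolventSecondDeriv (resolvent A z))
    (eventually_spectrum_subset hΩ hA) (fun B hB => ?_) (fun z hz => ?_) (fun B hB z hz => ?_)) (2 * Real.pi * Complex.I : ℂ)⁻¹
  · have h1 := continuousOn_resolvent hΩ hB
    exact hc.smul ((continuousOn_const.clm_apply h1).clm_apply h1)
  · have h1 := continuousAt_resolvent (isUnit_sub_of_mem_frontier hΩ hA hz)
    refine ContinuousAt.smul (f := fun p : (H →L[ℂ] H) × ℂ => φ p.2)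
      (g := fun p : (H →L[ℂ] H) × ℂ => resolventSecondDeriv (resolvent p.1 p.2)) ?_ ?_
    · exact ContinuousAt.comp (f := Prod.snd) (x := (A, z)) (hφ z (hfr hz)).continuousAt
        continuousAt_snd
    · exact ContinuousAt.comp (g := resolventSecondDeriv)
        (f := fun p : (H →L[ℂ] H) × ℂ => resolvent p.1 p.2)
        continuous_resolventSecondDeriv.continuousAt h1
  · have h1 := hasFDerivAt_resolvent (isUnit_sub_of_mem_frontier hΩ hB hz)
    exact ((ContinuousLinearMap.mulLeftRight ℂ (H →L[ℂ] H)).hasFDerivAt_of_bilinear h1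
      h1).fun_const_smul _

theorem fderiv_calculus_apply {A : H →L[ℂ] H} (hA : spectrum ℂ A ⊆ Ω) (G : H →L[ℂ] H) :
    fderiv ℂ (calculus Γ φ) A G = firstOrderTerm Γ φ A G := by
  have hc : ContinuousOn φ (frontier Ω) :=
    hφ.continuousOn.mono (frontier_subset_closure.trans hΩD)
  have h1 := continuousOn_resolvent hΩ hA
  rw [(hasFDerivAt_calculus Γ hΩ hΩD hφ hA).fderiv, smul_apply,
    firstOrderTerm]
  congr 1
  have := Γ.map_contourIntegral (ContinuousLinearMap.apply ℂ (H →L[ℂ] H) G)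
    (f := fun z => φ z • ContinuousLinearMap.mulLeftRight ℂ (H →L[ℂ] H) (resolvent A z)
      (resolvent A z)) (hc.smul ((continuousOn_const.clm_apply h1).clm_apply h1))
  simpa using this

theorem fderiv_fderiv_calculus_apply {A : H →L[ℂ] H} (hA : spectrum ℂ A ⊆ Ω) (G : H →L[ℂ] H) :
    fderiv ℂ (fderiv ℂ (calculus Γ φ)) A G G = (2 : ℂ) • secondOrderTerm Γ φ A G := by
  have hc : ContinuousOn φ (frontier Ω) :=
    hφ.continuousOn.mono (frontier_subset_closure.trans hΩD)
  have h1 := continuousOn_resolvent hΩ hA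
  rw [(hasFDerivAt_fderiv_calculus Γ hΩ hΩD hφ hA).fderiv, smul_apply,
    smul_apply, secondOrderTerm, smul_comm]
  congr 1
  have h2 := Γ.map_contourIntegral ((ContinuousLinearMap.apply ℂ (H →L[ℂ] H) G).comp
    (ContinuousLinearMap.apply ℂ ((H →L[ℂ] H) →L[ℂ] (H →L[ℂ] H)) G))
    (f := fun z => φ z • resolventSecondDeriv (resolvent A z))
    (hc.smul (continuous_resolventSecondDeriv.comp_continuousOn h1))
  have h3 := Γ.map_contourIntegral ((2 : ℂ) • ContinuousLinearMap.id ℂ (H →L[ℂ] H))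
    (f := fun z => φ z • (resolvent A z * (G * resolvent A z) ^ 2))
    (hc.smul (h1.mul ((continuousOn_const.mul h1).pow 2)))
  simp only [ContinuousLinearMap.comp_apply, ContinuousLinearMap.apply_apply,
    smul_apply, resolventSecondDeriv_apply, ContinuousLinearMap.id_apply]
    at h2 h3
  rw [h2, h3]
  simp only [smul_comm (2 : ℂ)]

end Calculus

end ResolventCalculus

/-! ### Pinchings along orthogonal projections. -/

namespace ResolventCalculus

variable {H : Type*} [NormedAddCommGroup H] [InnerProductSpace ℂ H] [CompleteSpace H]

section OrthogonalProjections

variable {κ : Type*} {p : κ → H →L[ℂ] H}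

theorem isStarProjection_sum (hp : ∀ i, IsStarProjection (p i))
    (ho : Pairwise fun i j => p i * p j = 0) (s : Finset κ) :
    IsStarProjection (∑ i ∈ s, p i) := by
  classical
  refine ⟨?_, ?_⟩
  · simp only [IsIdempotentElem, Finset.sum_mul_sum]
    refine Finset.sum_congr rfl fun i hi => ?_
    rw [Finset.sum_eq_single_of_mem i hi fun j _ hj => ho hj.symm, (hp i).isIdempotentElem.eq]
  · simp only [IsSelfAdjoint, star_sum]
    exact Finset.sum_congr rfl fun i _ => (hp i).isSelfAdjoint.star_eq

theorem norm_sum_projection_le (hp : ∀ i, IsStarProjection (p i))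
    (ho : Pairwise fun i j => p i * p j = 0) (s : Finset κ) : ‖∑ i ∈ s, p i‖ ≤ 1 :=
  IsStarProjection.norm_le _ (isStarProjection_sum hp ho s)

theorem orthogonalFamily_range (hp : ∀ i, IsStarProjection (p i))
    (ho : Pairwise fun i j => p i * p j = 0) :
    OrthogonalFamily ℂ (fun i => (p i).range) fun i => (p i).range.subtypeₗᵢ := by
  rintro i j hij ⟨_, u, rfl⟩ ⟨_, v, rfl⟩
  have h := (hp i).isSelfAdjoint.isSymmetric u (p j v)
  have h0 : p i (p j v) = 0 := congr($(ho hij) v)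
  change inner ℂ (p i u) (p j v) = 0
  change inner ℂ (p i u) (p j v) = inner ℂ u (p i (p j v)) at h
  rw [h, h0, inner_zero_right]

theorem norm_sq_sum_projection (hp : ∀ i, IsStarProjection (p i))
    (ho : Pairwise fun i j => p i * p j = 0) (y : κ → H) (s : Finset κ) :
    ‖∑ i ∈ s, p i (y i)‖ ^ 2 = ∑ i ∈ s, ‖p i (y i)‖ ^ 2 :=
  (orthogonalFamily_range hp ho).norm_sum (fun i => ⟨p i (y i), y i, rfl⟩) s

theorem sum_norm_sq_projection_le (hp : ∀ i, IsStarProjection (p i))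
    (ho : Pairwise fun i j => p i * p j = 0) (x : H) (s : Finset κ) :
    ∑ i ∈ s, ‖p i x‖ ^ 2 ≤ ‖x‖ ^ 2 := by
  rw [← norm_sq_sum_projection hp ho (fun _ => x), ← sum_apply]
  gcongr
  simpa using ContinuousLinearMap.le_of_opNorm_le _ (norm_sum_projection_le hp ho s) x

theorem norm_projection_apply_le (hp : ∀ i, IsStarProjection (p i)) (i : κ) (x : H) :
    ‖p i x‖ ≤ ‖x‖ := by
  simpa using ContinuousLinearMap.le_of_opNorm_le _ (IsStarProjection.norm_le _ (hp i)) x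

/-- Each term is at most `‖X‖ * ‖p i x‖`, and Bessel's inequality sums the squares. Since the terms
are mutually orthogonal, this gives both convergence and contractivity of the pinching. -/
theorem sum_norm_sq_compression_le (hp : ∀ i, IsStarProjection (p i))
    (ho : Pairwise fun i j => p i * p j = 0) (X : H →L[ℂ] H) (x : H) (s : Finset κ) :
    ∑ i ∈ s, ‖p i (X (p i x))‖ ^ 2 ≤ (‖X‖ * ‖x‖) ^ 2 := by
  calc ∑ i ∈ s, ‖p i (X (p i x))‖ ^ 2 ≤ ∑ i ∈ s, ‖X‖ ^ 2 * ‖p i x‖ ^ 2 := by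
        refine Finset.sum_le_sum fun i _ => ?_
        rw [← mul_pow]
        gcongr
        exact (norm_projection_apply_le hp i _).trans (X.le_opNorm _)
    _ ≤ (‖X‖ * ‖x‖) ^ 2 := by
        rw [← Finset.mul_sum, mul_pow]
        gcongr
        exact sum_norm_sq_projection_le hp ho x s

theorem summable_compression (hp : ∀ i, IsStarProjection (p i))
    (ho : Pairwise fun i j => p i * p j = 0) (X : H →L[ℂ] H) (x : H) :
    Summable fun i => p i (X (p i x)) :=
  ((orthogonalFamily_range hp ho).summable_iff_norm_sq_summable
    (fun i => ⟨p i (X (p i x)), X (p i x), rfl⟩)).2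
    (summable_of_sum_le (fun _ => by positivity) (sum_norm_sq_compression_le hp ho X x))

theorem norm_tsum_compression_le (hp : ∀ i, IsStarProjection (p i))
    (ho : Pairwise fun i j => p i * p j = 0) (X : H →L[ℂ] H) (x : H) :
    ‖∑' i, p i (X (p i x))‖ ≤ ‖X‖ * ‖x‖ := by
  refine le_of_tendsto (summable_compression hp ho X x).hasSum.norm
    (Eventually.of_forall fun s => ?_)
  refine (sq_le_sq₀ (norm_nonneg _) (by positivity)).1 ?_
  rw [norm_sq_sum_projection hp ho (fun i => X (p i x))]
  exact sum_norm_sq_compression_le hp ho X x s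

/-- The pinching `X ↦ ∑ i, p i X p i` along a family of mutually orthogonal projections. -/
noncomputable def pinching (hp : ∀ i, IsStarProjection (p i))
    (ho : Pairwise fun i j => p i * p j = 0) : (H →L[ℂ] H) →L[ℂ] (H →L[ℂ] H) :=
  LinearMap.mkContinuous₂ (LinearMap.mk₂ ℂ (fun X x => ∑' i, p i (X (p i x)))
    (fun X Y x => by
      rw [← (summable_compression hp ho X x).tsum_add (summable_compression hp ho Y x)]
      simp)
    (fun c X x => by
      rw [← (summable_compression hp ho X x).tsum_const_smul c]
      simp)
    (fun X x y => by
      rw [← (summable_compression hp ho X x).tsum_add (summable_compression hp ho X y)]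
      simp)
    (fun c X x => by
      rw [← (summable_compression hp ho X x).tsum_const_smul c]
      simp)) 1 (fun X x => by simpa using norm_tsum_compression_le hp ho X x)

theorem pinching_apply (hp : ∀ i, IsStarProjection (p i))
    (ho : Pairwise fun i j => p i * p j = 0) (X : H →L[ℂ] H) (x : H) :
    pinching hp ho X x = ∑' i, p i (X (p i x)) := rfl

theorem pinching_apply_of_mem (hp : ∀ i, IsStarProjection (p i))
    (ho : Pairwise fun i j => p i * p j = 0) (X : H →L[ℂ] H) {i : κ} {x : H} (hx : p i x = x) :
    pinching hp ho X x = p i (X x) := by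
  rw [pinching_apply, tsum_eq_single i, hx]
  intro j hj
  have : p j x = 0 := by
    rw [← hx]
    exact congr($(ho hj) x)
  rw [this, map_zero, map_zero]

end OrthogonalProjections

theorem tendsto_clm_apply_of_norm_le {H : Type*} [NormedAddCommGroup H] [InnerProductSpace ℂ H]
    {α : Type*} {l : Filter α} {A : α → H →L[ℂ] H}
    {B : H →L[ℂ] H} {y : α → H} {z : H} {C : ℝ} (hC : ∀ a, ‖A a‖ ≤ C)
    (hA : ∀ x, Tendsto (fun a => A a x) l (𝓝 (B x))) (hy : Tendsto y l (𝓝 z)) :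
    Tendsto (fun a => A a (y a)) l (𝓝 (B z)) := by
  have h : Tendsto (fun a => A a (y a - z)) l (𝓝 0) := by
    have h1 : Tendsto (fun a => C * ‖y a - z‖) l (𝓝 0) := by
      simpa using ((hy.sub_const z).norm).const_mul C
    exact squeeze_zero_norm (fun a => (A a).le_of_opNorm_le (hC a) _) h1
  simpa using h.add (hA z)

/-! ### Eigenexpansions and strong convergence of box sums. -/

namespace IsEigenExpansion

variable {ι : Type*} {T : H →L[ℂ] H} {lam : ι → ℝ} {P : ι → H →L[ℂ] H}
  (hP : IsEigenExpansion T lam P)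

include hP

theorem mul_self (i : ι) : P i * P i = P i := (hP.isStarProjection i).isIdempotentElem.eq

theorem apply_apply (i : ι) (x : H) : P i (P i x) = P i x := congr($(hP.mul_self i) x)

theorem ne_zero (i : ι) : P i ≠ 0 := by
  intro h
  have := hP.finrank_range i
  rw [h, show (0 : H →L[ℂ] H).range = ⊥ from LinearMap.range_zero, finrank_bot] at this
  exact zero_ne_one this

theorem operator_mul (i : ι) : T * P i = (lam i : ℂ) • P i := by
  ext x
  refine (hP.expansion (P i x)).unique ?_
  convert hasSum_single i ?_ using 1
  · simp [hP.apply_apply]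
  · intro j hj
    have : P j (P i x) = 0 := congr($(hP.orthogonal hj) x)
    simp [this]

theorem mul_operator (i : ι) : P i * T = (lam i : ℂ) • P i := by
  ext x
  refine ((hP.expansion x).mapL (P i)).unique ?_
  convert hasSum_single i ?_ using 1
  · simp [hP.apply_apply]
  · intro j hj
    have : P i (P j x) = 0 := congr($(hP.orthogonal hj.symm) x)
    simp [this]

theorem mem_spectrum (i : ι) : (lam i : ℂ) ∈ spectrum ℂ T := by
  intro h
  refine hP.ne_zero i (h.mul_left_cancel ?_)
  rw [sub_mul, hP.operator_mul, ← Algebra.smul_def, sub_self, mul_zero]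

theorem resolvent_mul {z : ℂ} (hz : IsUnit (algebraMap ℂ (H →L[ℂ] H) z - T)) {i : ι}
    (hi : z ≠ lam i) : resolvent T z * P i = (z - lam i)⁻¹ • P i := by
  have h : (algebraMap ℂ (H →L[ℂ] H) z - T) * P i = (z - lam i) • P i := by
    rw [sub_mul, hP.operator_mul, ← Algebra.smul_def, sub_smul]
  have h1 := congrArg (resolvent T z * ·) h
  simp only [resolvent, ← mul_assoc, Ring.inverse_mul_cancel _ hz, one_mul, mul_smul_comm] at h1
  rw [eq_inv_smul_iff₀ (sub_ne_zero.2 hi), resolvent, ← h1]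

theorem mul_resolvent {z : ℂ} (hz : IsUnit (algebraMap ℂ (H →L[ℂ] H) z - T)) {i : ι}
    (hi : z ≠ lam i) : P i * resolvent T z = (z - lam i)⁻¹ • P i := by
  have h : P i * (algebraMap ℂ (H →L[ℂ] H) z - T) = (z - lam i) • P i := by
    rw [mul_sub, hP.mul_operator, ← Algebra.commutes, ← Algebra.smul_def, sub_smul]
  have h1 := congrArg (· * resolvent T z) h
  simp only [resolvent, mul_assoc, Ring.mul_inverse_cancel _ hz, mul_one, smul_mul_assoc] at h1
  rw [eq_inv_smul_iff₀ (sub_ne_zero.2 hi), resolvent, ← h1]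

theorem norm_sum_le (F : Finset ι) : ‖∑ i ∈ F, P i‖ ≤ 1 :=
  norm_sum_projection_le hP.isStarProjection hP.orthogonal F

theorem tendsto_sum (x : H) : Tendsto (fun F : Finset ι => (∑ i ∈ F, P i) x) atTop (𝓝 x) := by
  simp only [sum_apply]
  exact hP.complete x

/-- Each vector is moved off `0` by only countably many `P i`. An index missed by all vectors of a
countable dense set would have `P i = 0`. Countability makes `atTop` on finite index sets countably
generated, as dominated convergence requires. -/
theorem countable [TopologicalSpace.SeparableSpace H] : Countable ι := by
  obtain ⟨s, hs, hd⟩ := TopologicalSpace.exists_countable_dense H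
  rw [← Set.countable_univ_iff]
  refine (hs.biUnion fun x _ => (hP.complete x).summable.countable_support).mono fun i _ => ?_
  by_contra h
  simp only [Set.mem_iUnion, Function.mem_support, not_exists, not_not] at h
  refine hP.ne_zero i (ContinuousLinearMap.ext fun x => ?_)
  exact congrFun ((P i).continuous.ext_on hd continuous_const fun y hy => h y hy) x

/-- A bounded net of operators that converges on the ranges of all `P k` converges strongly. -/
theorem tendsto_of_forall_range {α : Type*} {l : Filter α} {A : α → H →L[ℂ] H} {B : H →L[ℂ] H}
    {C : ℝ} (hC : ∀ a, ‖A a‖ ≤ C)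
    (h : ∀ k y, Tendsto (fun a => A a (P k y)) l (𝓝 (B (P k y)))) (x : H) :
    Tendsto (fun a => A a x) l (𝓝 (B x)) := by
  rw [Metric.tendsto_nhds]
  intro ε hε
  have hlim : Tendsto (fun F : Finset ι => (|C| + ‖B‖) * ‖(∑ i ∈ F, P i) x - x‖) atTop (𝓝 0) := by
    simpa using (((hP.tendsto_sum x).sub_const x).norm).const_mul (|C| + ‖B‖)
  obtain ⟨F, hF⟩ := (hlim.eventually_lt_const (half_pos hε)).exists
  set y := (∑ i ∈ F, P i) x with hy
  have hFy : Tendsto (fun a => A a y) l (𝓝 (B y)) := by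
    simp only [hy, sum_apply, map_sum]
    exact tendsto_finsetSum _ fun k _ => h k x
  filter_upwards [Metric.tendsto_nhds.1 hFy (ε / 2) (half_pos hε)] with a ha
  rw [dist_eq_norm] at ha ⊢
  have h1 : A a x - B x = (A a y - B y) - (A a (y - x) - B (y - x)) := by
    simp only [map_sub]
    abel
  have h2 := (A a).le_of_opNorm_le ((hC a).trans (le_abs_self C)) (y - x)
  have h3 := B.le_opNorm (y - x)
  rw [h1]
  calc _ ≤ ‖A a y - B y‖ + (‖A a (y - x)‖ + ‖B (y - x)‖) :=
        (norm_sub_le _ _).trans (by gcongr; exact norm_sub_le _ _)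
    _ < ε := by linarith

/-- A box sum is the compression of `S` by the partial sums of the `P i` on either side; these are
contractions tending strongly to `1`, so the two limits may be taken jointly. -/
theorem hasStrongSum₂ {S : H →L[ℂ] H} {a : ι → ι → H →L[ℂ] H}
    (h : ∀ i k, P i * S * P k = a i k) : HasStrongSum₂ a S := by
  intro x
  have h1 : Tendsto (fun F : Finset ι × Finset ι => S ((∑ k ∈ F.2, P k) x)) atTop (𝓝 (S x)) := by
    rw [← prod_atTop_atTop_eq]
    exact (S.continuous.tendsto x).comp ((hP.tendsto_sum x).comp tendsto_snd)
  have h2 := tendsto_clm_apply_of_norm_le (l := atTop)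
    (A := fun F : Finset ι × Finset ι => ∑ i ∈ F.1, P i) (B := 1) (fun F => hP.norm_sum_le F.1)
    (fun y => by
      rw [← prod_atTop_atTop_eq]
      exact (hP.tendsto_sum y).comp tendsto_fst) h1
  refine h2.congr fun F => ?_
  simp only [sum_apply, map_sum]
  refine Finset.sum_comm.trans ?_
  exact Finset.sum_congr rfl fun i _ => Finset.sum_congr rfl fun k _ => by simp [← h]

/-- The middle index enters through `Φ (∑ j ∈ F, P j)`, a net bounded by `‖Φ‖`. Its strong
convergence is combined with that of the two outer partial sums. -/
theorem hasStrongSum₃ {Φ : (H →L[ℂ] H) →L[ℂ] (H →L[ℂ] H)} {a : ι → ι → ι → H →L[ℂ] H}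
    (hΦ : ∀ x, Tendsto (fun F : Finset ι => Φ (∑ j ∈ F, P j) x) atTop (𝓝 (Φ 1 x)))
    (h : ∀ i j k, P i * Φ (P j) * P k = a i j k) : HasStrongSum₃ a (Φ 1) := by
  intro x
  have f1 : Tendsto (fun F : Finset ι × Finset ι × Finset ι => F.1) atTop atTop := by
    rw [← prod_atTop_atTop_eq]
    exact tendsto_fst
  have f2 : Tendsto (fun F : Finset ι × Finset ι × Finset ι => F.2.1) atTop atTop := by
    rw [← prod_atTop_atTop_eq, ← prod_atTop_atTop_eq]
    exact tendsto_fst.comp tendsto_snd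
  have f3 : Tendsto (fun F : Finset ι × Finset ι × Finset ι => F.2.2) atTop atTop := by
    rw [← prod_atTop_atTop_eq, ← prod_atTop_atTop_eq]
    exact tendsto_snd.comp tendsto_snd
  have h1 := tendsto_clm_apply_of_norm_le (C := ‖Φ‖)
    (A := fun F : Finset ι × Finset ι × Finset ι => Φ (∑ j ∈ F.2.1, P j)) (B := Φ 1)
    (fun F => (Φ.le_opNorm _).trans
      (mul_le_of_le_one_right (norm_nonneg _) (hP.norm_sum_le F.2.1)))
    (fun y => (hΦ y).comp f2) ((hP.tendsto_sum x).comp f3)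
  have h2 := tendsto_clm_apply_of_norm_le
    (A := fun F : Finset ι × Finset ι × Finset ι => ∑ i ∈ F.1, P i) (B := 1)
    (fun F => hP.norm_sum_le F.1) (fun y => (hP.tendsto_sum y).comp f1) h1
  refine h2.congr fun F => ?_
  simp only [Function.comp_apply, sum_apply, map_sum]
  refine (Finset.sum_congr rfl fun k _ => Finset.sum_comm).trans (Finset.sum_comm.trans ?_)
  refine Finset.sum_congr rfl fun i _ => Finset.sum_comm.trans ?_
  exact Finset.sum_congr rfl fun j _ => Finset.sum_congr rfl fun k _ => by simp [← h]

end IsEigenExpansion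

/-! ### Block diagonal parts with respect to the eigenspaces. -/

section Eigenprojection

/-- The orthogonal projection onto the eigenspace of `T` at the real number `μ`. -/
noncomputable def eigenprojection (T : H →L[ℂ] H) (μ : ℝ) : H →L[ℂ] H :=
  (Module.End.eigenspace (T : H →ₗ[ℂ] H) (μ : ℂ)).starProjection

theorem isStarProjection_eigenprojection (T : H →L[ℂ] H) (μ : ℝ) :
    IsStarProjection (eigenprojection T μ) := isStarProjection_starProjection

theorem pairwise_eigenprojection_mul {T : H →L[ℂ] H} (hT : IsSelfAdjoint T) :
    Pairwise fun μ ν => eigenprojection T μ * eigenprojection T ν = 0 := by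
  intro μ ν hμν
  refine Submodule.IsOrtho.starProjection_comp_starProjection ?_
  exact hT.isSymmetric.orthogonalFamily_eigenspaces.isOrtho (by exact_mod_cast hμν)

variable {ι : Type*} {T : H →L[ℂ] H} {lam : ι → ℝ} {P : ι → H →L[ℂ] H}
  (hT : IsSelfAdjoint T) (hP : IsEigenExpansion T lam P)

include hP

theorem IsEigenExpansion.eigenprojection_apply (i : ι) (x : H) :
    eigenprojection T (lam i) (P i x) = P i x := by
  refine Submodule.starProjection_eq_self_iff.2 (Module.End.mem_eigenspace_iff.2 ?_)
  exact congr($(hP.operator_mul i) x)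

include hT

theorem IsEigenExpansion.mul_eigenprojection (i : ι) (μ : ℝ) :
    P i * eigenprojection T μ = if lam i = μ then P i else 0 := by
  have h : eigenprojection T μ * P i = if lam i = μ then P i else 0 := by
    split_ifs with h
    · subst h
      exact ContinuousLinearMap.ext (hP.eigenprojection_apply i)
    · have h1 : P i = eigenprojection T (lam i) * P i :=
        (ContinuousLinearMap.ext (hP.eigenprojection_apply i)).symm
      rw [h1, ← mul_assoc, pairwise_eigenprojection_mul hT (Ne.symm h), zero_mul]
  have h2 := congrArg star h
  rw [star_mul, (hP.isStarProjection i).isSelfAdjoint.star_eq,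
    (isStarProjection_eigenprojection T μ).isSelfAdjoint.star_eq] at h2
  rw [h2]
  split_ifs
  · exact (hP.isStarProjection i).isSelfAdjoint.star_eq
  · exact star_zero _

/-- The block diagonal part of an operator with respect to the eigenspaces of `T`. -/
noncomputable abbrev blockDiagonal (hT : IsSelfAdjoint T) :
    (H →L[ℂ] H) →L[ℂ] (H →L[ℂ] H) :=
  pinching (isStarProjection_eigenprojection T) (pairwise_eigenprojection_mul hT)

/-- On the range of `P k` only the block of `lam k` survives, and `P i` annihilates that block
unless `lam i = lam k`. -/
theorem IsEigenExpansion.mul_blockDiagonal_mul (X : H →L[ℂ] H) (i k : ι) :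
    P i * blockDiagonal hT X * P k = if lam i = lam k then P i * X * P k else 0 := by
  ext x
  have h1 := pinching_apply_of_mem (isStarProjection_eigenprojection T)
    (pairwise_eigenprojection_mul hT) X (hP.eigenprojection_apply k x)
  have h2 := congr($(hP.mul_eigenprojection hT i (lam k)) (X (P k x)))
  simp only [mul_apply_eq_comp] at h2 ⊢
  rw [h1, h2]
  split_ifs <;> simp

/-- On the range of one `P k` the pinching is a single compression, where strong convergence is
immediate; boundedness extends it to all vectors. -/
theorem IsEigenExpansion.tendsto_blockDiagonal {α : Type*} {l : Filter α} {A : α → H →L[ℂ] H}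
    {B : H →L[ℂ] H} {C : ℝ} (hC : ∀ a, ‖A a‖ ≤ C)
    (h : ∀ x, Tendsto (fun a => A a x) l (𝓝 (B x))) (x : H) :
    Tendsto (fun a => blockDiagonal hT (A a) x) l (𝓝 (blockDiagonal hT B x)) := by
  refine hP.tendsto_of_forall_range (C := ‖blockDiagonal hT‖ * C)
    (fun a => (blockDiagonal hT).le_opNorm_of_le (hC a)) (fun k y => ?_) x
  simp only [pinching_apply_of_mem (isStarProjection_eigenprojection T)
    (pairwise_eigenprojection_mul hT) _ (hP.eigenprojection_apply k y)]
  exact ((eigenprojection T (lam k)).continuous.tendsto _).comp (h _)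

end Eigenprojection

end ResolventCalculus

/-! ### The second order term as a function of its middle factor. -/

namespace ResolventCalculus

variable {H : Type*} [NormedAddCommGroup H] [InnerProductSpace ℂ H] [CompleteSpace H]
  {Ω D : Set ℂ} (Γ : SmoothBoundary Ω) {φ : ℂ → ℂ}

/-- The map `X ↦ (1 / 2πi) ∫_Γ φ(z) R(z, T) U X R(z, T) V R(z, T) dz`. -/
noncomputable def sandwichTerm (φ : ℂ → ℂ) (T U V : H →L[ℂ] H) :
    (H →L[ℂ] H) →L[ℂ] (H →L[ℂ] H) :=
  (2 * Real.pi * Complex.I : ℂ)⁻¹ • contourIntegral Γ.γ (fun z => φ z •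
    ContinuousLinearMap.mulLeftRight ℂ (H →L[ℂ] H) (resolvent T z * U)
      (resolvent T z * V * resolvent T z))

section

variable (hΩ : IsOpen Ω) (hφ : ContinuousOn φ (frontier Ω)) {T : H →L[ℂ] H}
  (hT : spectrum ℂ T ⊆ Ω)

include hΩ hφ hT

theorem sandwichTerm_apply (U V X : H →L[ℂ] H) :
    sandwichTerm Γ φ T U V X = (2 * Real.pi * Complex.I : ℂ)⁻¹ • contourIntegral Γ.γ (fun z => φ z •
      (resolvent T z * U * X * (resolvent T z * V * resolvent T z))) := by
  have h1 := continuousOn_resolvent hΩ hT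
  rw [sandwichTerm, smul_apply]
  congr 1
  have := Γ.map_contourIntegral (ContinuousLinearMap.apply ℂ (H →L[ℂ] H) X)
    (f := fun z => φ z • ContinuousLinearMap.mulLeftRight ℂ (H →L[ℂ] H) (resolvent T z * U)
      (resolvent T z * V * resolvent T z))
    (hφ.smul ((continuousOn_const.clm_apply (h1.mul continuousOn_const)).clm_apply
      ((h1.mul continuousOn_const).mul h1)))
  simpa using this

theorem sandwichTerm_apply_one (G : H →L[ℂ] H) :
    sandwichTerm Γ φ T G G 1 = secondOrderTerm Γ φ T G := by
  rw [sandwichTerm_apply Γ hΩ hφ hT, secondOrderTerm]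
  simp only [mul_one, pow_two, mul_assoc]

/-- Dominated convergence along the contour, after evaluation at `x`: the operators `A a` converge
only strongly, so the limit cannot be taken inside an operator-valued integral. -/
theorem tendsto_sandwichTerm {α : Type*} {l : Filter α} [l.IsCountablyGenerated]
    {A : α → H →L[ℂ] H} {B : H →L[ℂ] H} {C : ℝ} (hC : ∀ a, ‖A a‖ ≤ C)
    (hA : ∀ x, Tendsto (fun a => A a x) l (𝓝 (B x))) (U V : H →L[ℂ] H) (x : H) :
    Tendsto (fun a => sandwichTerm Γ φ T U V (A a) x) l
      (𝓝 (sandwichTerm Γ φ T U V B x)) := by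
  have h1 := continuousOn_resolvent hΩ hT
  have hl : ContinuousOn (fun z => φ z • (resolvent T z * U)) (frontier Ω) :=
    hφ.smul (h1.mul continuousOn_const)
  have hr : ContinuousOn (fun z => (resolvent T z * V * resolvent T z) x) (frontier Ω) :=
    ((h1.mul continuousOn_const).mul h1).clm_apply continuousOn_const
  have key : ∀ X : H →L[ℂ] H, sandwichTerm Γ φ T U V X x =
      (2 * Real.pi * Complex.I : ℂ)⁻¹ • contourIntegral Γ.γ (fun z =>
        (φ z • (resolvent T z * U)) (X ((resolvent T z * V * resolvent T z) x))) := by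
    intro X
    rw [sandwichTerm_apply Γ hΩ hφ hT, smul_apply]
    congr 1
    have := Γ.map_contourIntegral (ContinuousLinearMap.apply ℂ H x)
      (f := fun z => φ z • (resolvent T z * U * X * (resolvent T z * V * resolvent T z)))
      (hφ.smul (((h1.mul continuousOn_const).mul continuousOn_const).mul
        ((h1.mul continuousOn_const).mul h1)))
    simpa using this
  simp only [key]
  refine Tendsto.const_smul (tendsto_finsetSum _ fun k _ => ?_) _
  have hcl := Γ.continuous_integrand hl k
  have hcr := Γ.continuous_comp hr k
  have hX : ∀ X : H →L[ℂ] H, Continuous fun t => deriv (Γ.γ k) t •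
      (φ (Γ.γ k t) • (resolvent T (Γ.γ k t) * U))
        (X ((resolvent T (Γ.γ k t) * V * resolvent T (Γ.γ k t)) x)) := fun X =>
    hcl.clm_apply (X.continuous.comp hcr)
  refine intervalIntegral.tendsto_integral_filter_of_dominated_convergence
    (fun t => ‖deriv (Γ.γ k) t • φ (Γ.γ k t) • (resolvent T (Γ.γ k t) * U)‖ *
      (C * ‖(resolvent T (Γ.γ k t) * V * resolvent T (Γ.γ k t)) x‖))
    (Eventually.of_forall fun a => (hX (A a)).aestronglyMeasurable)
    (Eventually.of_forall fun a => Eventually.of_forall fun t _ => ?_)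
    ((hcl.norm.mul (continuous_const.mul hcr.norm)).intervalIntegrable _ _)
    (Eventually.of_forall fun t _ => ?_)
  · rw [← smul_apply]
    exact ContinuousLinearMap.le_opNorm_of_le _ (ContinuousLinearMap.le_of_opNorm_le _ (hC a) _)
  · exact (((φ (Γ.γ k t) • (resolvent T (Γ.γ k t) * U)).continuous.tendsto _).comp
      (hA _)).const_smul _

end

/-! ### Matrix entries of the derivatives and their series. -/

namespace IsEigenExpansion

variable {ι : Type*} {T : H →L[ℂ] H} {lam : ι → ℝ} {P : ι → H →L[ℂ] H}
  (hP : IsEigenExpansion T lam P)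
  (hΩ : IsOpen Ω) (hΩb : Bornology.IsBounded Ω) (hT : spectrum ℂ T ⊆ Ω) (hD : IsOpen D)
  (hΩD : closure Ω ⊆ D) (hφ : AnalyticOnNhd ℂ φ D)

include hP hΩ hΩb hT hD hΩD hφ

theorem mul_firstOrderTerm_mul (G : H →L[ℂ] H) (i k : ι) :
    P i * firstOrderTerm Γ φ T G * P k = dslope φ (lam i) (lam k) • (P i * G * P k) := by
  have hφc : ContinuousOn φ (frontier Ω) :=
    hφ.continuousOn.mono (frontier_subset_closure.trans hΩD)
  have h1 := continuousOn_resolvent hΩ hT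
  have hm := fun i => hT (hP.mem_spectrum i)
  have hL := Γ.map_contourIntegral (ContinuousLinearMap.mulLeftRight ℂ (H →L[ℂ] H) (P i) (P k))
    (f := fun z => φ z • (resolvent T z * G * resolvent T z))
    (hφc.smul ((h1.mul continuousOn_const).mul h1))
  simp only [ContinuousLinearMap.mulLeftRight_apply] at hL
  have hc : contourIntegral Γ.γ
      (fun z => P i * (φ z • (resolvent T z * G * resolvent T z)) * P k) =
      contourIntegral Γ.γ (fun z => (φ z * ((z - lam i)⁻¹ * (z - lam k)⁻¹)) • (P i * G * P k)) := by
    refine Γ.contourIntegral_congr fun z hz => ?_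
    have hu := isUnit_sub_of_mem_frontier hΩ hT hz
    have e1 := hP.mul_resolvent hu (SmoothBoundary.ne_of_mem_frontier hΩ (hm i) hz)
    have e2 := hP.resolvent_mul hu (SmoothBoundary.ne_of_mem_frontier hΩ (hm k) hz)
    calc _ = φ z • ((P i * resolvent T z) * G * (resolvent T z * P k)) := by
          simp only [mul_smul_comm, smul_mul_assoc, mul_assoc]
      _ = _ := by
          rw [e1, e2]
          simp only [mul_smul_comm, smul_mul_assoc, smul_smul]
          congr 1
          ring
  rw [firstOrderTerm, mul_smul_comm, smul_mul_assoc, hL, hc, Γ.contourIntegral_smul_const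
    (f := fun z => φ z * ((z - (lam i : ℂ))⁻¹ * (z - (lam k : ℂ))⁻¹)) (hφc.mul ((SmoothBoundary.continuousOn_inv_sub hΩ (hm i)).mul
      (SmoothBoundary.continuousOn_inv_sub hΩ (hm k)))),
    Γ.cauchy_formula_dslope hΩ hΩb hD hΩD hφ (hm i) (hm k), smul_smul,
    inv_mul_cancel_left₀ Complex.two_pi_I_ne_zero]

theorem mul_sandwichTerm_mul (U V : H →L[ℂ] H) (i j k : ι) :
    P i * sandwichTerm Γ φ T U V (P j) * P k =
      dslope (dslope φ (lam i)) (lam j) (lam k) • (P i * U * P j * V * P k) := by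
  have hφc : ContinuousOn φ (frontier Ω) :=
    hφ.continuousOn.mono (frontier_subset_closure.trans hΩD)
  have h1 := continuousOn_resolvent hΩ hT
  have hm := fun i => hT (hP.mem_spectrum i)
  have hL := Γ.map_contourIntegral (ContinuousLinearMap.mulLeftRight ℂ (H →L[ℂ] H) (P i) (P k))
    (f := fun z => φ z • (resolvent T z * U * P j * (resolvent T z * V * resolvent T z)))
    (hφc.smul (((h1.mul continuousOn_const).mul continuousOn_const).mul
        ((h1.mul continuousOn_const).mul h1)))
  simp only [ContinuousLinearMap.mulLeftRight_apply] at hL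
  have hc : contourIntegral Γ.γ (fun z =>
      P i * (φ z • (resolvent T z * U * P j * (resolvent T z * V * resolvent T z))) * P k) =
      contourIntegral Γ.γ (fun z =>
        (φ z * ((z - lam i)⁻¹ * (z - lam j)⁻¹ * (z - lam k)⁻¹)) • (P i * U * P j * V * P k)) := by
    refine Γ.contourIntegral_congr fun z hz => ?_
    have hu := isUnit_sub_of_mem_frontier hΩ hT hz
    have e1 := hP.mul_resolvent hu (SmoothBoundary.ne_of_mem_frontier hΩ (hm i) hz)
    have e2 := hP.mul_resolvent hu (SmoothBoundary.ne_of_mem_frontier hΩ (hm j) hz)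
    have e3 := hP.resolvent_mul hu (SmoothBoundary.ne_of_mem_frontier hΩ (hm k) hz)
    calc _ = φ z • ((P i * resolvent T z) * U * (P j * resolvent T z) * V *
          (resolvent T z * P k)) := by
          simp only [mul_smul_comm, smul_mul_assoc, mul_assoc]
      _ = _ := by
          rw [e1, e2, e3]
          simp only [mul_smul_comm, smul_mul_assoc, smul_smul]
          congr 1
          ring
  rw [sandwichTerm_apply Γ hΩ hφc hT, mul_smul_comm, smul_mul_assoc, hL, hc,
    Γ.contourIntegral_smul_const
    (f := fun z => φ z * ((z - (lam i : ℂ))⁻¹ * (z - (lam j : ℂ))⁻¹ * (z - (lam k : ℂ))⁻¹))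
    (hφc.mul (((SmoothBoundary.continuousOn_inv_sub hΩ (hm i)).mul
      (SmoothBoundary.continuousOn_inv_sub hΩ (hm j))).mul
      (SmoothBoundary.continuousOn_inv_sub hΩ (hm k)))),
    Γ.cauchy_formula_dslope_dslope hΩ hΩb hD hΩD hφ (hm i) (hm j) (hm k), smul_smul,
    inv_mul_cancel_left₀ Complex.two_pi_I_ne_zero]

/-- The series expansion of the first derivative. -/
theorem exists_hasStrongSum₂_firstOrderTerm (hTsa : IsSelfAdjoint T) (G : H →L[ℂ] H) :
    ∃ A B : H →L[ℂ] H,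
      HasStrongSum₂ (fun i k => weightEqual₂ φ (lam i) (lam k) • (P i * G * P k)) A ∧
      HasStrongSum₂ (fun i k => weightDistinct₂ φ (lam i) (lam k) • (P i * G * P k)) B ∧
      firstOrderTerm Γ φ T G = A + B := by
  set S := firstOrderTerm Γ φ T G with hS
  have h1 := hP.mul_firstOrderTerm_mul Γ hΩ hΩb hT hD hΩD hφ G
  have h2 : ∀ i k, P i * blockDiagonal hTsa S * P k =
      weightEqual₂ φ (lam i) (lam k) • (P i * G * P k) := by
    intro i k
    rw [hP.mul_blockDiagonal_mul hTsa, h1, weightEqual₂_eq]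
    split_ifs <;> simp
  -- The block diagonal part carries exactly the entries with equal eigenvalues; the complement
  -- carries the others.
  refine ⟨blockDiagonal hTsa S, S - blockDiagonal hTsa S, hP.hasStrongSum₂ h2,
    hP.hasStrongSum₂ fun i k => ?_, (add_sub_cancel _ _).symm⟩
  rw [mul_sub, sub_mul, h2, h1, dslope_eq_weight, add_smul, add_sub_cancel_left]

/-- The series expansion of the second derivative. -/
theorem exists_hasStrongSum₃_secondOrderTerm [Countable ι] (hTsa : IsSelfAdjoint T)
    (G : H →L[ℂ] H) :
    ∃ A B C : H →L[ℂ] H,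
      HasStrongSum₃ (fun i j k =>
        weightDistinct₃ φ (lam i) (lam j) (lam k) • (P i * G * P j * G * P k)) A ∧
      HasStrongSum₃ (fun i j k =>
        weightTwoEqual₃ φ (lam i) (lam j) (lam k) • (P i * G * P j * G * P k)) B ∧
      HasStrongSum₃ (fun i j k =>
        weightAllEqual₃ φ (lam i) (lam j) (lam k) • (P i * G * P j * G * P k)) C ∧
      secondOrderTerm Γ φ T G = A + B + C := by
  have hφc : ContinuousOn φ (frontier Ω) :=
    hφ.continuousOn.mono (frontier_subset_closure.trans hΩD)
  have han := fun i => hφ _ (hΩD (subset_closure (hT (hP.mem_spectrum i))))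
  set G' := blockDiagonal hTsa G with hG'
  have hlim : ∀ U V x, Tendsto (fun F : Finset ι => sandwichTerm Γ φ T U V (∑ j ∈ F, P j) x) atTop
      (𝓝 (sandwichTerm Γ φ T U V 1 x)) :=
    tendsto_sandwichTerm Γ hΩ hφc hT hP.norm_sum_le hP.tendsto_sum
  set Φ := sandwichTerm Γ φ T G G with hΦ
  set Φall := sandwichTerm Γ φ T G' G' with hΦall
  set Φ₁₂ := sandwichTerm Γ φ T G' G with hΦ₁₂
  set Φ₂₃ := sandwichTerm Γ φ T G G' with hΦ₂₃
  -- Equality of the outer eigenvalues involves neither factor `G` alone, so here the whole output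
  -- is pinched.
  set Φ₁₃ := (blockDiagonal hTsa).comp Φ with hΦ₁₃
  set Φtwo := Φ₁₂ + Φ₂₃ + Φ₁₃ - (3 : ℂ) • Φall with hΦtwo
  have hlim₁₃ : ∀ x, Tendsto (fun F : Finset ι => Φ₁₃ (∑ j ∈ F, P j) x) atTop
      (𝓝 (Φ₁₃ 1 x)) := by
    intro x
    refine hP.tendsto_blockDiagonal hTsa (C := ‖Φ‖) (fun F => ?_) (hlim G G) x
    exact (Φ.le_opNorm _).trans (mul_le_of_le_one_right (norm_nonneg _) (hP.norm_sum_le F))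
  have hlimtwo : ∀ x, Tendsto (fun F : Finset ι => Φtwo (∑ j ∈ F, P j) x) atTop
      (𝓝 (Φtwo 1 x)) := fun x =>
    (((hlim G' G x).add (hlim G G' x)).add (hlim₁₃ x)).sub ((hlim G' G' x).const_smul (3 : ℂ))
  have hblock := hP.mul_blockDiagonal_mul hTsa
  -- Doubling `P j` separates the two factors, so that the block diagonal rule applies to each.
  have split : ∀ U V i j k, P i * U * P j * V * P k = (P i * U * P j) * (P j * V * P k) := by
    intro U V i j k
    conv_lhs => rw [← hP.mul_self j]
    simp only [mul_assoc]
  have hc := hP.mul_sandwichTerm_mul Γ hΩ hΩb hT hD hΩD hφ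
  have c₀ : ∀ i j k, P i * Φ (P j) * P k =
      dslope (dslope φ (lam i)) (lam j) (lam k) • (P i * G * P j * G * P k) := hc G G
  have call : ∀ i j k, P i * Φall (P j) * P k =
      weightAllEqual₃ φ (lam i) (lam j) (lam k) • (P i * G * P j * G * P k) := by
    intro i j k
    rw [hΦall, hc, weightAllEqual₃_eq (han i), split G', split G, hG', hblock, hblock]
    split_ifs <;> simp_all
  have c₁₂ : ∀ i j k, P i * Φ₁₂ (P j) * P k = (if lam i = lam j then
      dslope (dslope φ (lam i)) (lam j) (lam k) else 0) • (P i * G * P j * G * P k) := by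
    intro i j k
    rw [hΦ₁₂, hc, split G', split G, hG', hblock]
    split_ifs <;> simp
  have c₂₃ : ∀ i j k, P i * Φ₂₃ (P j) * P k = (if lam j = lam k then
      dslope (dslope φ (lam i)) (lam j) (lam k) else 0) • (P i * G * P j * G * P k) := by
    intro i j k
    rw [hΦ₂₃, hc, split G G', split G G, hG', hblock]
    split_ifs <;> simp
  have c₁₃ : ∀ i j k, P i * Φ₁₃ (P j) * P k = (if lam i = lam k then
      dslope (dslope φ (lam i)) (lam j) (lam k) else 0) • (P i * G * P j * G * P k) := by
    intro i j k
    rw [hΦ₁₃, ContinuousLinearMap.comp_apply, hblock, c₀]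
    split_ifs <;> simp
  have ctwo : ∀ i j k, P i * Φtwo (P j) * P k =
      weightTwoEqual₃ φ (lam i) (lam j) (lam k) • (P i * G * P j * G * P k) := by
    intro i j k
    have : P i * Φtwo (P j) * P k = P i * Φ₁₂ (P j) * P k + P i * Φ₂₃ (P j) * P k +
        P i * Φ₁₃ (P j) * P k - (3 : ℂ) • (P i * Φall (P j) * P k) := by
      simp only [hΦtwo, sub_apply, add_apply, smul_apply, mul_sub, mul_add, sub_mul, add_mul,
        mul_smul_comm, smul_mul_assoc]
    rw [this, c₁₂, c₂₃, c₁₃, call, weightTwoEqual₃_eq (han j), weightAllEqual₃_eq (han i)]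
    simp only [sub_smul, add_smul, mul_smul]
  refine ⟨(Φ - Φtwo - Φall) 1, Φtwo 1, Φall 1, hP.hasStrongSum₃ ?_ ?_,
    hP.hasStrongSum₃ hlimtwo ctwo, hP.hasStrongSum₃ (hlim G' G') call, ?_⟩
  · exact fun x => ((hlim G G x).sub (hlimtwo x)).sub (hlim G' G' x)
  · intro i j k
    have : P i * (Φ - Φtwo - Φall) (P j) * P k = P i * Φ (P j) * P k - P i * Φtwo (P j) * P k -
        P i * Φall (P j) * P k := by
      simp only [sub_apply, mul_sub, sub_mul]
    rw [this, c₀, ctwo, call, dslope_dslope_eq_weight (han i) (han j)]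
    simp only [add_smul]
    abel
  · rw [← sandwichTerm_apply_one Γ hΩ hφc hT, ← hΦ]
    simp only [sub_apply]
    abel

end IsEigenExpansion

end ResolventCalculus

theorem mainTheorem7
    {H : Type*} [NormedAddCommGroup H] [InnerProductSpace ℂ H] [CompleteSpace H]
    [TopologicalSpace.SeparableSpace H]
    {ι : Type*} (T : H →L[ℂ] H) (hTsa : IsSelfAdjoint T) (hTc : IsCompactOperator T)
    (lam : ι → ℝ) (P : ι → H →L[ℂ] H) (hP : IsEigenExpansion T lam P)
    (Ω D : Set ℂ) (hΩo : IsOpen Ω) (hΩb : Bornology.IsBounded Ω) (Γ : SmoothBoundary Ω)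
    (hσ : spectrum ℂ T ⊆ Ω) (hD : IsOpen D) (hΩD : closure Ω ⊆ D)
    (φ : ℂ → ℂ) (hφ : AnalyticOnNhd ℂ φ D) :
    (∀ᶠ A in 𝓝 T, spectrum ℂ A ⊆ Ω ∧
      DifferentiableAt ℂ (calculus Γ φ : (H →L[ℂ] H) → (H →L[ℂ] H)) A) ∧
    DifferentiableAt ℂ (fderiv ℂ (calculus Γ φ : (H →L[ℂ] H) → (H →L[ℂ] H))) T ∧
    ∀ G : H →L[ℂ] H,
      (fderiv ℂ (calculus Γ φ) T G = firstOrderTerm Γ φ T G ∧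
        ∃ A B : H →L[ℂ] H,
          HasStrongSum₂ (fun i k => weightEqual₂ φ (lam i) (lam k) • (P i * G * P k)) A ∧
          HasStrongSum₂ (fun i k => weightDistinct₂ φ (lam i) (lam k) • (P i * G * P k)) B ∧
          firstOrderTerm Γ φ T G = A + B) ∧
      (fderiv ℂ (fderiv ℂ (calculus Γ φ)) T G G = (2 : ℂ) • secondOrderTerm Γ φ T G ∧
        ∃ A B C : H →L[ℂ] H,
          HasStrongSum₃ (fun i j k =>
            weightDistinct₃ φ (lam i) (lam j) (lam k) • (P i * G * P j * G * P k)) A ∧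
          HasStrongSum₃ (fun i j k =>
            weightTwoEqual₃ φ (lam i) (lam j) (lam k) • (P i * G * P j * G * P k)) B ∧
          HasStrongSum₃ (fun i j k =>
            weightAllEqual₃ φ (lam i) (lam j) (lam k) • (P i * G * P j * G * P k)) C ∧
          secondOrderTerm Γ φ T G = A + B + C) := by
  refine ⟨?_, (hasFDerivAt_fderiv_calculus Γ hΩo hΩD hφ hσ).differentiableAt, fun G => ⟨⟨?_, ?_⟩,
    ⟨?_, ?_⟩⟩⟩
  · filter_upwards [eventually_spectrum_subset hΩo hσ] with A hA
    exact ⟨hA, (hasFDerivAt_calculus Γ hΩo hΩD hφ hA).differentiableAt⟩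
  · exact fderiv_calculus_apply Γ hΩo hΩD hφ hσ G
  · exact hP.exists_hasStrongSum₂_firstOrderTerm Γ hΩo hΩb hσ hD hΩD hφ hTsa G
  · exact fderiv_fderiv_calculus_apply Γ hΩo hΩD hφ hσ G
  · have := hP.countable
    exact hP.exists_hasStrongSum₃_secondOrderTerm Γ hΩo hΩb hσ hD hΩD hφ hTsa G
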